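/- Let $(M,\tau)$ be a finite-dimensional unital C*-algebra over $\mathbb{C}$ with a faithful tracial state, viewed as a metric structure $\mathcal{M}$ in the language of tracial $\mathrm{W}^*$-algebras. This language has function symbols for $+$, $\cdot$, $*$, scalar multiplications, $0$, $1$ and non-commutative polynomials, and relation symbols $\operatorname{Re}\tau$ and $\operatorname{Im}\tau$. The metric is $d(x,y)=\tau((x-y)^*(x-y))^{1/2}$ and the domains of quantification are the operator-norm balls $\{\|x\|\le r\}$, $r>0$. Let $A\subseteq M$ be a unital $*$-subalgebra, with the restricted trace. The definable closure $\operatorname{dcl}^{\mathcal{M}}(A)$ is the set of $x\in M$ such that the distance function $d(\cdot,\{x\})$ is a definable predicate over $A$. The algebraic closure $\operatorname{acl}^{\mathcal{M}}(A)$ is the set of $x\in M$ that belong to some compact subset $K$ of a domain of quantification such that $d(\cdot,K)$ is a definable predicate over $A$. (A definable predicate over $A$ is one in the language with constants for the elements of $A$, relative to the theory of $\mathcal{M}$ with these constants: on each domain it is a limit of formulas, uniformly over all models.) There are $*$-isomorphisms $$M\cong\bigoplus_{j=1}^{J}M_{n_j}(\mathbb{C}),\qquad A\cong\bigoplus_{i=1}^{I}M_{m_i}(\mathbb{C})\qquad(n_j,m_i\ge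 1),$$ real numbers $\beta_j$ and integers $k(i,j)\ge 0$ such that $\tau=\bigoplus_{j}\beta_j\operatorname{tr}_{n_j}$ with $\operatorname{tr}_n$ the normalized trace, and such that, in these coordinates, the inclusion $A\subseteq M$ is $$\bigoplus_{i=1}^{I}x_i\ \longmapsto\ \bigoplus_{j=1}^{J}\operatorname{diag}(\underbrace{x_1,\dots,x_1}_{k(1,j)},\dots,\underbrace{x_I,\dots,x_I}_{k(I,j)}),$$ up to the order in which the rows and columns of each block are listed. For every such decomposition, declare $j\sim j'$ if $n_j=n_{j'}$, $\beta_j=\beta_{j'}$ and $k(i,j)=k(i,j')$ for all $i$. For an equivalence class $C$, let $p_C\in M$ be the central projection onto $\bigoplus_{j\in C}M_{n_j}(\mathbb{C})$. Then $$\operatorname{dcl}^{\mathcal{M}}(A)=\operatorname{span}_{\mathbb{C}}\{p_C\,a:\ a\in A,\ C\text{ an equivalence class}\}.$$ Moreover, $\operatorname{acl}^{\mathcal{M}}(A)=M$. -/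

import Mathlib

open scoped NNReal ComplexOrder

universe u v w

noncomputable section

/-! ### Metric signatures, structures and formulas (one sort, with domains of quantification) -/

/-- A modulus of continuity: a continuous increasing function `[0,∞) → [0,∞)` vanishing at `0`. -/
structure Modulus where
  toFun : ℝ≥0 → ℝ≥0
  continuous_toFun : Continuous toFun
  monotone_toFun : Monotone toFun
  map_zero : toFun 0 = 0

instance : CoeFun Modulus fun _ => ℝ≥0 → ℝ≥0 := ⟨Modulus.toFun⟩

/-- The modulus `t ↦ K t`. -/
def Modulus.linear (K : ℝ≥0) : Modulus where
  toFun t := K * t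
  continuous_toFun := by fun_prop
  monotone_toFun := fun _ _ h => mul_le_mul_right h K
  map_zero := mul_zero K

/-- A metric signature with a single sort; the distance symbol is built into `Formula`. -/
structure MetricSignature where
  /-- domains of quantification -/
  Dom : Type
  /-- the assigned bounds on the distance between points of two domains -/
  diamBound : Dom → Dom → ℝ
  /-- function symbols -/
  Func : Type v
  arity : Func → ℕ
  funcRange : (f : Func) → (Fin (arity f) → Dom) → Dom
  funcMod : (f : Func) → (Fin (arity f) → Dom) → Fin (arity f) → Modulus
  /-- relation symbols -/
  Rel : Type
  relArity : Rel → ℕ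
  relBound : (R : Rel) → (Fin (relArity R) → Dom) → ℝ≥0
  relMod : (R : Rel) → (Fin (relArity R) → Dom) → Fin (relArity R) → Modulus

namespace MetricSignature

/-- The signature `L_A`: a constant symbol is added for each element of `A`; `dom a` is the
domain that the constant `a` is assigned to. -/
def withConstants (L : MetricSignature.{v}) (A : Type w) (dom : A → L.Dom) :
    MetricSignature.{max v w} where
  Dom := L.Dom
  diamBound := L.diamBound
  Func := L.Func ⊕ A
  arity := Sum.elim L.arity fun _ => 0
  funcRange
    | .inl f, D => L.funcRange f D
    | .inr a, _ => dom a
  funcMod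
    | .inl f, D, i => L.funcMod f D i
    | .inr _, _, i => Fin.elim0 i
  Rel := L.Rel
  relArity := L.relArity
  relBound := L.relBound
  relMod := L.relMod

end MetricSignature

/-- A structure for a metric signature. -/
structure MetricStructure (L : MetricSignature.{v}) where
  carrier : Type u
  metric : MetricSpace carrier
  domain : L.Dom → Set carrier
  domain_complete : ∀ D, IsComplete (domain D)
  exists_domain : ∀ x, ∃ D, x ∈ domain D
  dist_le : ∀ D D', ∀ x ∈ domain D, ∀ y ∈ domain D', dist x y ≤ L.diamBound D D'
  func : (f : L.Func) → (Fin (L.arity f) → carrier) → carrier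
  func_mem : ∀ f D x, (∀ i, x i ∈ domain (D i)) → func f x ∈ domain (L.funcRange f D)
  func_mod : ∀ f D x, (∀ i, x i ∈ domain (D i)) → ∀ i, ∀ y ∈ domain (D i),
    dist (func f x) (func f (Function.update x i y)) ≤ L.funcMod f D i (nndist (x i) y)
  rel : (R : L.Rel) → (Fin (L.relArity R) → carrier) → ℝ
  rel_bound : ∀ R D x, (∀ i, x i ∈ domain (D i)) → |rel R x| ≤ L.relBound R D
  rel_mod : ∀ R D x, (∀ i, x i ∈ domain (D i)) → ∀ i, ∀ y ∈ domain (D i),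
    |rel R x - rel R (Function.update x i y)| ≤ L.relMod R D i (nndist (x i) y)

attribute [instance] MetricStructure.metric

namespace MetricSignature

/-- Terms in the variables `x₀, …, x_{n-1}`. -/
inductive Term (L : MetricSignature.{v}) (n : ℕ) : Type v
  | var : Fin n → Term L n
  | func : (f : L.Func) → (Fin (L.arity f) → Term L n) → Term L n

/-- Formulas with free variables among `x₀, …, x_{n-1}`; the quantifiers bind the last variable. -/
inductive Formula (L : MetricSignature.{v}) : ℕ → Type v
  | dist {n : ℕ} : L.Term n → L.Term n → Formula L n
  | rel {n : ℕ} : (R : L.Rel) → (Fin (L.relArity R) → L.Term n) → Formula L n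
  | conn {n m : ℕ} : C(Fin m → ℝ, ℝ) → (Fin m → Formula L n) → Formula L n
  | sup {n : ℕ} : L.Dom → Formula L (n + 1) → Formula L n
  | inf {n : ℕ} : L.Dom → Formula L (n + 1) → Formula L n

/-- A sentence is a formula without free variables. -/
abbrev Sentence (L : MetricSignature.{v}) : Type v := L.Formula 0

variable {L : MetricSignature.{v}}

/-- Interpretation of terms. -/
def Term.eval (N : MetricStructure.{u} L) {n : ℕ} (x : Fin n → N.carrier) : L.Term n → N.carrier
  | .var i => x i
  | .func f t => N.func f fun i => (t i).eval N x

/-- Interpretation of formulas. -/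
def Formula.eval (N : MetricStructure.{u} L) : {n : ℕ} → L.Formula n → (Fin n → N.carrier) → ℝ
  | _, .dist s t, x => Dist.dist (s.eval N x) (t.eval N x)
  | _, .rel R t, x => N.rel R fun i => (t i).eval N x
  | _, .conn F φ, x => F fun i => (φ i).eval N x
  | _, .sup D φ, x => ⨆ y : N.domain D, φ.eval N (Fin.snoc x y.1)
  | _, .inf D φ, x => ⨅ y : N.domain D, φ.eval N (Fin.snoc x y.1)

/-- The value of a sentence in a structure. -/
def Sentence.value (σ : L.Sentence) (N : MetricStructure.{u} L) : ℝ := Formula.eval N σ Fin.elim0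

end MetricSignature

namespace MetricStructure

variable {L : MetricSignature.{v}}

/-- `N` is a model of the theory `T`. -/
def Models (N : MetricStructure.{u} L) (T : Set L.Sentence) : Prop := ∀ σ ∈ T, σ.value N = 0

/-- The theory of `N`. -/
def theory (N : MetricStructure.{u} L) : Set L.Sentence := {σ | σ.value N = 0}

theorem models_theory (N : MetricStructure.{u} L) : N.Models N.theory := fun _ h => h

/-- A family of `n`-ary functions on the models of `T` is a definable predicate relative to `T`
if, on every product of domains, it is uniformly approximated in all models at once by formulas. -/
def IsDefinablePredicate (T : Set L.Sentence) {n : ℕ}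
    (φ : (N : MetricStructure.{u} L) → N.Models T → (Fin n → N.carrier) → ℝ) : Prop :=
  ∀ (D : Fin n → L.Dom) (ε : ℝ), 0 < ε → ∃ ψ : L.Formula n,
    ∀ (N : MetricStructure.{u} L) (hN : N.Models T) (x : Fin n → N.carrier),
      (∀ i, x i ∈ N.domain (D i)) → |φ N hN x - ψ.eval N x| < ε

/-- A domain that contains `x`. -/
def domainOf (M : MetricStructure.{u} L) (x : M.carrier) : L.Dom := (M.exists_domain x).choose

theorem mem_domainOf (M : MetricStructure.{u} L) (x : M.carrier) : x ∈ M.domain (M.domainOf x) :=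
  (M.exists_domain x).choose_spec

/-- The `L_A`-structure `M_A`, in which the constant symbol of `a ∈ A` is interpreted as `a`. -/
def expand (M : MetricStructure.{u} L) (A : Set M.carrier) :
    MetricStructure.{u} (L.withConstants A fun a => M.domainOf a) where
  carrier := M.carrier
  metric := M.metric
  domain := M.domain
  domain_complete := M.domain_complete
  exists_domain := M.exists_domain
  dist_le := M.dist_le
  func
    | .inl f, x => M.func f x
    | .inr a, _ => a.1
  func_mem
    | .inl f, D, x, h => M.func_mem f D x h
    | .inr a, _, _, _ => M.mem_domainOf a.1
  func_mod
    | .inl f, D, x, h, i, y, hy => M.func_mod f D x h i y hy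
    | .inr _, _, _, _, i, _, _ => Fin.elim0 i
  rel := M.rel
  rel_bound := M.rel_bound
  rel_mod := M.rel_mod

/-- A closed set `C` is definable over `A` if `d(x, C) = φ(x)` for some definable predicate `φ`
in the language `L_A` relative to the theory of `M_A`. -/
def IsDefinableOver (M : MetricStructure.{u} L) (A C : Set M.carrier) : Prop :=
  IsClosed C ∧
    ∃ φ : (N : MetricStructure.{u} (L.withConstants A fun a => M.domainOf a)) →
        N.Models (M.expand A).theory → (Fin 1 → N.carrier) → ℝ,
      IsDefinablePredicate (M.expand A).theory φ ∧
        ∀ x : M.carrier,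
          Metric.infDist x C = φ (M.expand A) (models_theory _) fun _ => x

/-- The definable closure of `A` in `M`. -/
def dcl (M : MetricStructure.{u} L) (A : Set M.carrier) : Set M.carrier :=
  {x | M.IsDefinableOver A {x}}

/-- The algebraic closure of `A` in `M`. -/
def acl (M : MetricStructure.{u} L) (A : Set M.carrier) : Set M.carrier :=
  {x | ∃ (D : L.Dom) (C : Set M.carrier),
    C ⊆ M.domain D ∧ x ∈ C ∧ IsCompact C ∧ M.IsDefinableOver A C}

end MetricStructure

/-! ### Tracial algebras -/

/-- A faithful tracial state on a unital C*-algebra. -/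
structure FaithfulTrace (M : Type u) [CStarAlgebra M] where
  toLinearMap : M →ₗ[ℂ] ℂ
  nonneg : ∀ x, 0 ≤ toLinearMap (star x * x)
  map_one : toLinearMap 1 = 1
  mul_comm : ∀ x y, toLinearMap (x * y) = toLinearMap (y * x)
  faithful : ∀ x, toLinearMap (star x * x) = 0 → x = 0

namespace FaithfulTrace

instance (M : Type u) [CStarAlgebra M] : CoeFun (FaithfulTrace M) fun _ => M → ℂ :=
  ⟨fun τ => τ.toLinearMap⟩

variable {M : Type u} [CStarAlgebra M] (τ : FaithfulTrace M)

/-- The norm `‖x‖₂ = τ(x* x)^{1/2}`. -/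
def norm₂ (x : M) : ℝ := √(τ (star x * x)).re

theorem im_selfAdjoint (h : M) (hh : star h = h) : (τ h).im = 0 := by
  have key : ∀ x : M, (τ (star x * x)).im = 0 := fun x =>
    ((Complex.nonneg_iff.1 (τ.nonneg x)).2).symm
  have h1 := key (1 + h)
  have h2 := key h
  have h3 : τ (star (1 + h) * (1 + h)) = 1 + 2 * τ h + τ (star h * h) := by
    have : star (1 + h) * (1 + h) = 1 + ((2 : ℂ) • h + star h * h) := by
      rw [star_add, star_one, hh, two_smul]; noncomm_ring
    rw [this, map_add, map_add, map_smul, τ.map_one, smul_eq_mul, add_assoc]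
  rw [h3] at h1
  simp only [Complex.add_im, Complex.one_im, Complex.mul_im, Complex.re_ofNat, Complex.im_ofNat,
    h2] at h1
  linarith

theorem map_star (x : M) : τ (star x) = starRingEnd ℂ (τ x) := by
  have h1 := τ.im_selfAdjoint (x + star x) (by simp [add_comm])
  have h2 := τ.im_selfAdjoint (Complex.I • (x - star x)) (by
    rw [star_smul, star_sub, star_star, Complex.star_def, Complex.conj_I, neg_smul, ← smul_neg,
      neg_sub])
  rw [map_add] at h1
  rw [map_smul, map_sub] at h2
  simp at h1 h2
  apply Complex.ext <;> simp <;> linarith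

/-- The inner product `⟨x, y⟩ = τ(x* y)`. -/
@[reducible]
def innerCore : InnerProductSpace.Core ℂ M where
  inner x y := τ (star x * y)
  conj_inner_symm x y := by
    change starRingEnd ℂ (τ (star y * x)) = τ (star x * y)
    rw [← τ.map_star, star_mul, star_star]
  re_inner_nonneg x := (Complex.nonneg_iff.1 (τ.nonneg x)).1
  add_left x y z := by
    change τ (star (x + y) * z) = τ (star x * z) + τ (star y * z)
    rw [star_add, add_mul, map_add]
  smul_left x y r := by
    change τ (star (r • x) * y) = starRingEnd ℂ r * τ (star x * y)
    rw [star_smul, smul_mul_assoc, map_smul]; rfl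
  definite x h := τ.faithful x h

theorem norm₂_nonneg (x : M) : 0 ≤ τ.norm₂ x := Real.sqrt_nonneg _

theorem norm₂_add_le (x y : M) : τ.norm₂ (x + y) ≤ τ.norm₂ x + τ.norm₂ y :=
  @norm_add_le M τ.innerCore.toNormedAddCommGroup.toSeminormedAddCommGroup.toSeminormedAddGroup x y

theorem norm₂_star (x : M) : τ.norm₂ (star x) = τ.norm₂ x := by
  unfold norm₂; rw [star_star, τ.mul_comm]

theorem norm₂_neg (x : M) : τ.norm₂ (-x) = τ.norm₂ x := by
  unfold norm₂; rw [star_neg, neg_mul_neg]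

theorem norm₂_zero : τ.norm₂ 0 = 0 := by simp [norm₂]

theorem norm₂_smul (c : ℂ) (x : M) : τ.norm₂ (c • x) = ‖c‖ * τ.norm₂ x := by
  unfold norm₂
  rw [star_smul, smul_mul_smul_comm, map_smul, smul_eq_mul]
  have : star c * c = ((‖c‖ ^ 2 : ℝ) : ℂ) := by
    rw [Complex.star_def, Complex.conj_mul', Complex.ofReal_pow]
  rw [this, Complex.re_ofReal_mul, Real.sqrt_mul (by positivity), Real.sqrt_sq (norm_nonneg c)]

theorem norm₂_mul_le (x y : M) : τ.norm₂ (x * y) ≤ ‖x‖ * τ.norm₂ y := by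
  let _ := CStarAlgebra.spectralOrder M
  have _ := CStarAlgebra.spectralOrderedRing M
  have h : star y * (star x * x) * y ≤ ‖star x * x‖ • (star y * y) :=
    CStarAlgebra.star_left_conjugate_le_norm_smul (hb := IsSelfAdjoint.star_mul_self x)
  obtain ⟨s, hs⟩ := CStarAlgebra.nonneg_iff_eq_star_mul_self.1 (sub_nonneg.2 h)
  have h0 := (Complex.nonneg_iff.1 (τ.nonneg s)).1
  rw [← hs, map_sub, Complex.sub_re, CStarRing.norm_star_mul_self,
    ← Complex.coe_smul, map_smul, smul_eq_mul, Complex.re_ofReal_mul] at h0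
  unfold norm₂
  rw [← Real.sqrt_sq (norm_nonneg x), ← Real.sqrt_mul (by positivity)]
  apply Real.sqrt_le_sqrt
  have : star (x * y) * (x * y) = star y * (star x * x) * y := by
    rw [star_mul]; noncomm_ring
  rw [this, pow_two]
  linarith

theorem norm₂_mul_le' (x y : M) : τ.norm₂ (x * y) ≤ τ.norm₂ x * ‖y‖ := by
  rw [← norm₂_star, star_mul, _root_.mul_comm, ← norm₂_star τ x, ← norm_star y]
  exact τ.norm₂_mul_le _ _

theorem norm₂_le (x : M) : τ.norm₂ x ≤ ‖x‖ := by
  simpa [norm₂, τ.map_one] using τ.norm₂_mul_le x 1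

theorem norm_map_le (x : M) : ‖τ x‖ ≤ τ.norm₂ x := by
  have h := @InnerProductSpace.Core.norm_inner_le_norm ℂ M _ _ _ τ.innerCore.toCore 1 x
  have h1 : ‖τ (star 1 * x)‖ ≤ τ.norm₂ 1 * τ.norm₂ x := h
  simpa [norm₂, τ.map_one] using h1

/-- The metric `d(x, y) = ‖x - y‖₂`. -/
@[reducible]
def metricSpace₂ : MetricSpace M where
  dist x y := τ.norm₂ (x - y)
  dist_self x := by rw [sub_self, norm₂_zero]
  dist_comm x y := by rw [← norm₂_neg, neg_sub]
  dist_triangle x y z := by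
    have := τ.norm₂_add_le (x - y) (y - z)
    rwa [sub_add_sub_cancel] at this
  eq_of_dist_eq_zero {x y} h := by
    have h' : (τ (star (x - y) * (x - y))).re = 0 :=
      (Real.sqrt_eq_zero (Complex.nonneg_iff.1 (τ.nonneg _)).1).1 h
    exact sub_eq_zero.1
      (τ.faithful _ (Complex.ext h' (Complex.nonneg_iff.1 (τ.nonneg _)).2.symm))

end FaithfulTrace

/-! ### The language of tracial W*-algebras -/

/-- The function symbols; `poly p n` evaluates the non-commutative polynomial `p`. -/
inductive TrFunc : Type
  | add | mul | star | smul (c : ℂ) | zero | one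
  | poly {d : ℕ} (p : FreeAlgebra ℂ (Fin d)) (n : ℕ)

/-- The relation symbols: real and imaginary part of the trace. -/
inductive TrRel : Type
  | reTr | imTr

def TrFunc.arity : TrFunc → ℕ
  | .add | .mul => 2
  | .star | .smul _ => 1
  | .zero | .one => 0
  | .poly (d := d) _ _ => d

/-- The supremum of `‖p(X)‖` over all tuples with `‖X i‖ ≤ r i` in algebras with a faithful tracial
state. (Such an algebra embeds isometrically in the tracial W*-algebra that it generates.) -/
def polyBound {d : ℕ} (p : FreeAlgebra ℂ (Fin d)) (r : Fin d → {r : ℝ // 0 < r}) : ℝ :=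
  sSup {b | ∃ (N : Type u) (_ : CStarAlgebra N) (_ : FaithfulTrace N) (X : Fin d → N),
    (∀ i, ‖X i‖ ≤ r i) ∧ b = ‖FreeAlgebra.lift ℂ X p‖}

/-- `K` is a Lipschitz constant for `p(X)` in the variable `X i` in the `2`-norm, for tuples with
`‖X i‖ ≤ r i`. -/
def IsPolyLip {d : ℕ} (p : FreeAlgebra ℂ (Fin d)) (r : Fin d → {r : ℝ // 0 < r}) (i : Fin d)
    (K : ℝ≥0) : Prop :=
  ∀ (N : Type u) (_ : CStarAlgebra N) (τ : FaithfulTrace N) (X : Fin d → N) (y : N),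
    (∀ i, ‖X i‖ ≤ r i) → ‖y‖ ≤ r i →
      τ.norm₂ (FreeAlgebra.lift ℂ X p - FreeAlgebra.lift ℂ (Function.update X i y) p) ≤
        K * τ.norm₂ (X i - y)

/-- The best such Lipschitz constant. -/
def polyLip {d : ℕ} (p : FreeAlgebra ℂ (Fin d)) (r : Fin d → {r : ℝ // 0 < r}) (i : Fin d) : ℝ≥0 :=
  sInf {K | IsPolyLip.{u} p r i K}

theorem norm_map_algebraMap_le {N : Type u} [CStarAlgebra N] (c : ℂ) :
    ‖algebraMap ℂ N c‖ ≤ ‖c‖ := by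
  rw [norm_algebraMap]
  rcases subsingleton_or_nontrivial N with h | h
  · rw [Subsingleton.elim (1 : N) 0, norm_zero, mul_zero]; exact norm_nonneg c
  · rw [norm_one, mul_one]

theorem exists_poly_bound {d : ℕ} (p : FreeAlgebra ℂ (Fin d)) (r : Fin d → {r : ℝ // 0 < r}) :
    ∃ B : ℝ≥0, ∀ (N : Type u) (_ : CStarAlgebra N) (X : Fin d → N),
      (∀ i, ‖X i‖ ≤ r i) → ‖FreeAlgebra.lift ℂ X p‖ ≤ B := by
  induction p using FreeAlgebra.induction with
  | grade0 c =>
    refine ⟨‖c‖₊, fun N _ X _ => ?_⟩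
    rw [AlgHom.commutes]
    exact norm_map_algebraMap_le c
  | grade1 i =>
    refine ⟨⟨r i, (r i).2.le⟩, fun N _ X h => ?_⟩
    rw [FreeAlgebra.lift_ι_apply]
    exact h i
  | mul a b ha hb =>
    obtain ⟨A, hA⟩ := ha
    obtain ⟨B, hB⟩ := hb
    refine ⟨A * B, fun N _ X h => ?_⟩
    rw [map_mul]
    refine (norm_mul_le _ _).trans ?_
    push_cast
    exact mul_le_mul (hA N _ X h) (hB N _ X h) (norm_nonneg _) A.2
  | add a b ha hb =>
    obtain ⟨A, hA⟩ := ha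
    obtain ⟨B, hB⟩ := hb
    refine ⟨A + B, fun N _ X h => ?_⟩
    rw [map_add]
    refine (norm_add_le _ _).trans ?_
    push_cast
    exact add_le_add (hA N _ X h) (hB N _ X h)

theorem exists_isPolyLip {d : ℕ} (p : FreeAlgebra ℂ (Fin d)) (r : Fin d → {r : ℝ // 0 < r})
    (i : Fin d) : ∃ K, IsPolyLip.{u} p r i K := by
  have hup : ∀ (N : Type u) (_ : CStarAlgebra N) (X : Fin d → N) (y : N),
      (∀ i, ‖X i‖ ≤ r i) → ‖y‖ ≤ r i → ∀ j, ‖Function.update X i y j‖ ≤ r j := by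
    intro N _ X y hX hy j
    by_cases hj : j = i
    · subst hj; simpa using hy
    · simpa [Function.update_of_ne hj] using hX j
  induction p using FreeAlgebra.induction with
  | grade0 c =>
    refine ⟨0, fun N _ τ X y _ _ => ?_⟩
    rw [AlgHom.commutes, AlgHom.commutes, sub_self, τ.norm₂_zero]
    simp
  | grade1 j =>
    refine ⟨1, fun N _ τ X y _ _ => ?_⟩
    rw [FreeAlgebra.lift_ι_apply, FreeAlgebra.lift_ι_apply, NNReal.coe_one, one_mul]
    by_cases hj : j = i
    · subst hj; simp
    · rw [Function.update_of_ne hj, sub_self, τ.norm₂_zero]; exact τ.norm₂_nonneg _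
  | mul a b ha hb =>
    obtain ⟨A, hA⟩ := ha
    obtain ⟨B, hB⟩ := hb
    obtain ⟨A', hA'⟩ := exists_poly_bound.{u} a r
    obtain ⟨B', hB'⟩ := exists_poly_bound.{u} b r
    refine ⟨A' * B + A * B', fun N _ τ X y hX hy => ?_⟩
    rw [map_mul, map_mul]
    set a₁ := FreeAlgebra.lift ℂ X a
    set b₁ := FreeAlgebra.lift ℂ X b
    set a₂ := FreeAlgebra.lift ℂ (Function.update X i y) a
    set b₂ := FreeAlgebra.lift ℂ (Function.update X i y) b
    have e : a₁ * b₁ - a₂ * b₂ = a₁ * (b₁ - b₂) + (a₁ - a₂) * b₂ := by noncomm_ring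
    rw [e]
    have h1 : τ.norm₂ (a₁ * (b₁ - b₂)) ≤ A' * (B * τ.norm₂ (X i - y)) :=
      (τ.norm₂_mul_le _ _).trans
        (mul_le_mul (hA' N _ X hX) (hB N _ τ X y hX hy) (τ.norm₂_nonneg _) A'.2)
    have h2 : τ.norm₂ ((a₁ - a₂) * b₂) ≤ (A * τ.norm₂ (X i - y)) * B' :=
      (τ.norm₂_mul_le' _ _).trans
        (mul_le_mul (hA N _ τ X y hX hy) (hB' N _ _ (hup N _ X y hX hy)) (norm_nonneg _)
          (mul_nonneg A.2 (τ.norm₂_nonneg _)))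
    refine (τ.norm₂_add_le _ _).trans ((add_le_add h1 h2).trans (le_of_eq ?_))
    push_cast
    ring
  | add a b ha hb =>
    obtain ⟨A, hA⟩ := ha
    obtain ⟨B, hB⟩ := hb
    refine ⟨A + B, fun N _ τ X y hX hy => ?_⟩
    rw [map_add, map_add, add_sub_add_comm]
    refine (τ.norm₂_add_le _ _).trans ?_
    push_cast
    rw [add_mul]
    exact add_le_add (hA N _ τ X y hX hy) (hB N _ τ X y hX hy)

theorem polyBound_nonneg {d : ℕ} (p : FreeAlgebra ℂ (Fin d)) (r : Fin d → {r : ℝ // 0 < r}) :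
    0 ≤ polyBound.{u} p r := by
  apply Real.sSup_nonneg
  rintro b ⟨N, _, _, X, _, rfl⟩
  exact norm_nonneg _

theorem norm_poly_le {M : Type u} [CStarAlgebra M] (τ : FaithfulTrace M) {d : ℕ}
    (p : FreeAlgebra ℂ (Fin d)) (r : Fin d → {r : ℝ // 0 < r}) (X : Fin d → M)
    (hX : ∀ i, ‖X i‖ ≤ r i) : ‖FreeAlgebra.lift ℂ X p‖ ≤ polyBound.{u} p r := by
  obtain ⟨B, hB⟩ := exists_poly_bound.{u} p r
  refine le_csSup ⟨B, ?_⟩ ⟨M, _, τ, X, hX, rfl⟩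
  rintro b ⟨N, _, _, X, h, rfl⟩
  exact hB N _ X h

theorem isPolyLip_polyLip {d : ℕ} (p : FreeAlgebra ℂ (Fin d)) (r : Fin d → {r : ℝ // 0 < r})
    (i : Fin d) : IsPolyLip.{u} p r i (polyLip.{u} p r i) := by
  obtain ⟨K, hK⟩ := exists_isPolyLip.{u} p r i
  intro N _ τ X y hX hy
  rcases (τ.norm₂_nonneg (X i - y)).eq_or_lt with h | h
  · have := hK N _ τ X y hX hy
    rw [← h, mul_zero] at this ⊢
    exact this
  · rw [← div_le_iff₀ h]
    set t : ℝ≥0 := Real.toNNReal (τ.norm₂ (FreeAlgebra.lift ℂ X p -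
        FreeAlgebra.lift ℂ (Function.update X i y) p) / τ.norm₂ (X i - y)) with ht
    have hle : t ≤ polyLip.{u} p r i :=
      le_csInf ⟨K, hK⟩ fun K' hK' =>
        Real.toNNReal_le_iff_le_coe.2 ((div_le_iff₀ h).2 (hK' N _ τ X y hX hy))
    exact Real.toNNReal_le_iff_le_coe.1 hle

/-- The language of tracial W*-algebras. The domains are the radii `r > 0`, and `poly p n` is
assigned the range bound `M_p + 1 / (n + 1)`, where `M_p` is `polyBound p`. -/
def trSignature : MetricSignature.{0} where
  Dom := {r : ℝ // 0 < r}
  diamBound r s := r + s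
  Func := TrFunc
  arity := TrFunc.arity
  funcRange
    | .add, r => ⟨(r (0 : Fin 2)).1 + (r (1 : Fin 2)).1, add_pos (r _).2 (r _).2⟩
    | .mul, r => ⟨(r (0 : Fin 2)).1 * (r (1 : Fin 2)).1, mul_pos (r _).2 (r _).2⟩
    | .star, r => r (0 : Fin 1)
    | .smul c, r => ⟨max ‖c‖ 1 * (r (0 : Fin 1)).1, mul_pos (by positivity) (r _).2⟩
    | .zero, _ => ⟨1, one_pos⟩
    | .one, _ => ⟨1, one_pos⟩
    | .poly p n, r => ⟨polyBound.{u} p r + 1 / (n + 1),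
        add_pos_of_nonneg_of_pos (polyBound_nonneg p r) (by positivity)⟩
  funcMod
    | .add, _, _ => .linear 1
    | .mul, r, i => .linear ⟨(r (Fin.rev (n := 2) i)).1, (r _).2.le⟩
    | .star, _, _ => .linear 1
    | .smul c, _, _ => .linear ‖c‖₊
    | .zero, _, _ => .linear 0
    | .one, _, _ => .linear 0
    | .poly p _, r, i => .linear (polyLip.{u} p r i)
  Rel := TrRel
  relArity _ := 1
  relBound _ r := ⟨(r 0).1, (r 0).2.le⟩
  relMod _ _ _ := .linear 1

section

variable {M : Type u} [CStarAlgebra M] (τ : FaithfulTrace M)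

def trFuncInterp (M : Type u) [CStarAlgebra M] : (f : TrFunc) → (Fin f.arity → M) → M
  | .add, x => x (0 : Fin 2) + x (1 : Fin 2)
  | .mul, x => x (0 : Fin 2) * x (1 : Fin 2)
  | .star, x => star (x (0 : Fin 1))
  | .smul c, x => c • x (0 : Fin 1)
  | .zero, _ => 0
  | .one, _ => 1
  | .poly p _, x => FreeAlgebra.lift ℂ x p

def trRelInterp : TrRel → (Fin 1 → M) → ℝ
  | .reTr, x => (τ (x 0)).re
  | .imTr, x => (τ (x 0)).im

theorem trRelInterp_sub (R : TrRel) (x y : Fin 1 → M) :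
    |trRelInterp τ R x - trRelInterp τ R y| ≤ τ.norm₂ (x 0 - y 0) := by
  have h := τ.norm_map_le (x 0 - y 0)
  rw [map_sub] at h
  cases R
  · exact (Complex.abs_re_le_norm (τ (x 0) - τ (y 0))).trans h
  · exact (Complex.abs_im_le_norm (τ (x 0) - τ (y 0))).trans h

theorem add_mod₂ (x : Fin 2 → M) (i : Fin 2) (y : M) :
    τ.norm₂ ((x 0 + x 1) - (Function.update x i y 0 + Function.update x i y 1)) ≤
      (1 : ℝ) * τ.norm₂ (x i - y) := by
  fin_cases i
  · simp
  · simp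

theorem mul_mod₂ (r : Fin 2 → {r : ℝ // 0 < r}) (x : Fin 2 → M) (hx : ∀ i, ‖x i‖ ≤ (r i).1)
    (i : Fin 2) (y : M) :
    τ.norm₂ ((x 0 * x 1) - (Function.update x i y 0 * Function.update x i y 1)) ≤
      (r (Fin.rev i)).1 * τ.norm₂ (x i - y) := by
  fin_cases i
  · have h := τ.norm₂_mul_le' (x 0 - y) (x 1)
    have h' := mul_le_mul_of_nonneg_left (hx 1) (τ.norm₂_nonneg (x 0 - y))
    rw [sub_mul] at h
    rw [mul_comm ((r _).1)]
    simpa using h.trans h'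
  · have h := τ.norm₂_mul_le (x 0) (x 1 - y)
    have h' := mul_le_mul_of_nonneg_right (hx 0) (τ.norm₂_nonneg (x 1 - y))
    rw [mul_sub] at h
    simpa using h.trans h'

theorem star_mod₂ (x : Fin 1 → M) (i : Fin 1) (y : M) :
    τ.norm₂ (star (x 0) - star (Function.update x i y 0)) ≤ (1 : ℝ) * τ.norm₂ (x i - y) := by
  obtain rfl := Subsingleton.elim i 0
  rw [← star_sub, τ.norm₂_star, Function.update_self, one_mul]

theorem smul_mod₂ (c : ℂ) (x : Fin 1 → M) (i : Fin 1) (y : M) :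
    τ.norm₂ (c • x 0 - c • Function.update x i y 0) ≤ ‖c‖ * τ.norm₂ (x i - y) := by
  obtain rfl := Subsingleton.elim i 0
  rw [← smul_sub, τ.norm₂_smul, Function.update_self]

theorem rel_bound₂ (R : TrRel) (x : Fin 1 → M) : |trRelInterp τ R x| ≤ ‖x 0‖ := by
  have h := trRelInterp_sub τ R x 0
  have h0 : trRelInterp τ R (0 : Fin 1 → M) = 0 := by cases R <;> simp [trRelInterp]
  rw [h0, sub_zero, Pi.zero_apply, sub_zero] at h
  exact h.trans (τ.norm₂_le _)

theorem rel_mod₂ (R : TrRel) (x : Fin 1 → M) (i : Fin 1) (y : M) :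
    |trRelInterp τ R x - trRelInterp τ R (Function.update x i y)| ≤
      (1 : ℝ) * τ.norm₂ (x i - y) := by
  obtain rfl := Subsingleton.elim i 0
  have h := trRelInterp_sub τ R x (Function.update x 0 y)
  rwa [Function.update_self, ← one_mul (τ.norm₂ _)] at h

theorem ball_isComplete₂ [FiniteDimensional ℂ M] (r : ℝ) :
    @IsComplete M τ.metricSpace₂.toUniformSpace {x | ‖x‖ ≤ r} := by
  have : ProperSpace M := FiniteDimensional.proper ℂ M
  have hc : IsCompact {x : M | ‖x‖ ≤ r} := by
    have := isCompact_closedBall (0 : M) r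
    convert this using 1
    ext x; simp
  have hid : @Continuous M M _ τ.metricSpace₂.toUniformSpace.toTopologicalSpace id := by
    refine @LipschitzWith.continuous M M _ τ.metricSpace₂.toPseudoMetricSpace.toPseudoEMetricSpace
      1 id ?_
    refine @LipschitzWith.of_dist_le_mul M M _ τ.metricSpace₂.toPseudoMetricSpace 1 id ?_
    intro x y
    rw [NNReal.coe_one, one_mul, dist_eq_norm]
    exact τ.norm₂_le (x - y)
  have h := @IsCompact.image M M _ τ.metricSpace₂.toUniformSpace.toTopologicalSpace _ id hc hid
  rw [Set.image_id] at h
  exact @IsCompact.isComplete M τ.metricSpace₂.toUniformSpace _ h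

/-- A finite-dimensional tracial W*-algebra as a structure: the domains are the operator norm balls
and the metric comes from the `2`-norm. -/
def trStructure [FiniteDimensional ℂ M] : MetricStructure.{u} trSignature.{u} where
  carrier := M
  metric := τ.metricSpace₂
  domain r := {x | ‖x‖ ≤ r.1}
  domain_complete r := ball_isComplete₂ τ r.1
  exists_domain x := ⟨⟨‖x‖ + 1, by positivity⟩, by
    change ‖x‖ ≤ ‖x‖ + 1
    linarith⟩
  dist_le r s x hx y hy :=
    (τ.norm₂_le (x - y)).trans ((norm_sub_le x y).trans (add_le_add hx hy))
  func := trFuncInterp M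
  func_mem := by
    intro f r x hx
    cases f with
    | add => exact (norm_add_le _ _).trans (add_le_add (hx (0 : Fin 2)) (hx (1 : Fin 2)))
    | mul =>
      exact (norm_mul_le _ _).trans
        (mul_le_mul (hx (0 : Fin 2)) (hx (1 : Fin 2)) (norm_nonneg _) (r (0 : Fin 2)).2.le)
    | star =>
      change ‖star (x (0 : Fin 1))‖ ≤ _
      rw [norm_star]
      exact hx (0 : Fin 1)
    | smul c =>
      change ‖c • x (0 : Fin 1)‖ ≤ max ‖c‖ 1 * (r (0 : Fin 1)).1
      rw [norm_smul]
      exact mul_le_mul (le_max_left _ _) (hx (0 : Fin 1)) (norm_nonneg _) (by positivity)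
    | zero =>
      change ‖(0 : M)‖ ≤ 1
      simp
    | one =>
      change ‖(1 : M)‖ ≤ 1
      simpa using norm_map_algebraMap_le (N := M) 1
    | poly p n =>
      refine (norm_poly_le τ p r x hx).trans ?_
      change _ ≤ polyBound.{u} p r + 1 / ((n : ℝ) + 1)
      have : (0 : ℝ) ≤ 1 / ((n : ℝ) + 1) := by positivity
      linarith
  func_mod := by
    intro f r x hx i y hy
    cases f with
    | add => exact add_mod₂ τ x i y
    | mul => exact mul_mod₂ τ r x hx i y
    | star => exact star_mod₂ τ x i y
    | smul c => exact smul_mod₂ τ c x i y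
    | zero => exact Fin.elim0 i
    | one => exact Fin.elim0 i
    | poly p n => exact isPolyLip_polyLip p r i M _ τ x y hx hy
  rel := trRelInterp τ
  rel_bound R r x hx := (rel_bound₂ τ R x).trans (hx (0 : Fin 1))
  rel_mod R r x _ i y _ := rel_mod₂ τ R x i y

end

/-! ### Block decompositions of an inclusion -/

/-- A decomposition of the inclusion `A ⊆ M` into matrix blocks: `M ≅ ⨁ⱼ M_{n j}(ℂ)` with
`τ = ⨁ⱼ β j · tr_{n j}` (normalized traces), `A ≅ ⨁ᵢ M_{m i}(ℂ)`, and in these coordinates the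
`j`-th component of the inclusion is `⨁ᵢ xᵢ ↦ diag(x₁, …, x₁, …, x_I, …, x_I)` with `k i j` copies
of `xᵢ`. The bijection `coord j` lists the rows of the diagonal blocks; the index `⟨⟨i, l⟩, s⟩`
stands for the `s`-th row of the `l`-th copy of `xᵢ`. -/
structure BlockDecomposition {M : Type u} [CStarAlgebra M] (τ : FaithfulTrace M)
    (A : StarSubalgebra ℂ M) where
  J : ℕ
  I : ℕ
  n : Fin J → ℕ
  n_pos : ∀ j, 0 < n j
  β : Fin J → ℝ
  m : Fin I → ℕ
  m_pos : ∀ i, 0 < m i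
  k : Fin I → Fin J → ℕ
  blocks : M ≃⋆ₐ[ℂ] ((j : Fin J) → Matrix (Fin (n j)) (Fin (n j)) ℂ)
  subBlocks : A ≃⋆ₐ[ℂ] ((i : Fin I) → Matrix (Fin (m i)) (Fin (m i)) ℂ)
  trace_eq : ∀ x, τ x = ∑ j, (β j : ℂ) * ((blocks x j).trace / n j)
  coord : (j : Fin J) → (Σ p : (Σ i : Fin I, Fin (k i j)), Fin (m p.1)) ≃ Fin (n j)
  inclusion_eq : ∀ (a : A) (j : Fin J), blocks a j =
    Matrix.reindex (coord j) (coord j)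
      (Matrix.blockDiagonal' fun p : (Σ i : Fin I, Fin (k i j)) => subBlocks a p.1)

namespace BlockDecomposition

variable {M : Type u} [CStarAlgebra M] {τ : FaithfulTrace M} {A : StarSubalgebra ℂ M}

/-- Two blocks of `M` are equivalent if they have the same size, the same trace weight and the same
multiplicities. -/
def blockSetoid (B : BlockDecomposition τ A) : Setoid (Fin B.J) where
  r j j' := B.n j = B.n j' ∧ B.β j = B.β j' ∧ ∀ i, B.k i j = B.k i j'
  iseqv :=
    ⟨fun _ => ⟨rfl, rfl, fun _ => rfl⟩,
     fun h => ⟨h.1.symm, h.2.1.symm, fun i => (h.2.2 i).symm⟩,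
     fun h h' => ⟨h.1.trans h'.1, h.2.1.trans h'.2.1, fun i => (h.2.2 i).trans (h'.2.2 i)⟩⟩

open Classical in
/-- The central projection `p_C` of `M` onto `⨁_{j ∈ C} M_{n j}(ℂ)`. -/
def proj (B : BlockDecomposition τ A) (C : Set (Fin B.J)) : M :=
  B.blocks.symm fun j => if j ∈ C then 1 else 0

end BlockDecomposition

end

/-!
The definable closure of `A` is the algebra of fixed points of the trace preserving
`*`-endomorphisms of `M` over `A` (`traceFixedPoints_eq_dcl`), and this algebra is computed in the
coordinates of a block decomposition.

An automorphism of a metric structure preserves the values of formulas, so it fixes the definable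
closure (`MetricStructure.fixed_of_mem_dcl`). Conversely, let `x` be a fixed point and let `b` be a
linear basis of `M`. For a tuple `w` in a ball, a quantifier-free formula `endDefect` over `A`
measures how far the linear map `T_w` with `b i ↦ w i` is from being a trace preserving
`*`-endomorphism over `A`. Where it vanishes, `T_w x = x`. By compactness of the balls there is a
continuous function `α` with `α 0 = 0` and `d(T_w x, x) ≤ α (endDefect w)`
(`exists_continuous_modulus`), and therefore `d(z, x)` is the minimum over `w` of
`d(z, T_w x) + α (endDefect w)`, attained at `w = b`. This is the value of a single formula, so that
no model other than `M` has to be considered. The algebraic closure is everything for the simple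
reason that the balls themselves are compact and definable (`acl_eq_univ`).

An automorphism permutes the minimal central projections of `M`; if it preserves the trace and fixes
`A`, it preserves the sizes, weights and multiplicities of the blocks and hence fixes the
projections `p_C` (`BlockDecomposition.map_proj`). On the other hand, sign changes of the copies of
the blocks of `A`, permutations of these copies, and permutations of equivalent blocks of `M` are
trace preserving automorphisms over `A`. An element that is invariant under all of them is block
diagonal, with blocks that depend only on the class of the block of `M` and on the block of `A`
(`BlockDecomposition.traceFixedPoints_subset_span`).

For the existence of a decomposition, the Wedderburn–Artin theorem gives algebra isomorphisms; the
trace turns the simple modules into Hilbert spaces on which the algebra acts by `*`-representations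
(`exists_starAlgEquiv_pi_matrix`). Translating orthonormal bases of the ranges of minimal
projections by matrix units brings the inclusion into block diagonal form
(`Matrix.exists_unitary_conj_eq_blockDiagonal`).
-/

/-! ### Formulas and automorphisms -/

section Invariance

variable {L : MetricSignature.{v}}

/-- An automorphism of a metric structure commutes with the interpretation of terms. -/
theorem MetricSignature.Term.eval_comp_equiv (N : MetricStructure.{u} L)
    (σ : N.carrier ≃ N.carrier)
    (hfun : ∀ f x, σ (N.func f x) = N.func f fun i => σ (x i)) {n : ℕ}
    (t : L.Term n) (x : Fin n → N.carrier) :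
    t.eval N (fun i => σ (x i)) = σ (t.eval N x) := by
  induction t with
  | var i => rfl
  | func f t ih =>
    simp only [MetricSignature.Term.eval, ih, hfun]

/-- An automorphism of a metric structure preserves the values of formulas. -/
theorem MetricSignature.Formula.eval_comp_equiv (N : MetricStructure.{u} L)
    (σ : N.carrier ≃ N.carrier)
    (hfun : ∀ f x, σ (N.func f x) = N.func f fun i => σ (x i))
    (hdist : ∀ x y, Dist.dist (σ x) (σ y) = Dist.dist x y)
    (hrel : ∀ R x, N.rel R (fun i => σ (x i)) = N.rel R x)
    (hdom : ∀ D x, σ x ∈ N.domain D ↔ x ∈ N.domain D) {n : ℕ}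
    (φ : L.Formula n) (x : Fin n → N.carrier) :
    φ.eval N (fun i => σ (x i)) = φ.eval N x := by
  have hsnoc : ∀ {n : ℕ} (x : Fin n → N.carrier) (y : N.carrier),
      (Fin.snoc (fun i => σ (x i)) (σ y) : Fin (n + 1) → N.carrier) =
        fun i => σ ((Fin.snoc x y : Fin (n + 1) → N.carrier) i) := fun x y =>
    (Fin.comp_snoc σ x y).symm
  induction φ with
  | dist s t =>
    simp only [MetricSignature.Formula.eval, MetricSignature.Term.eval_comp_equiv N σ hfun, hdist]
  | rel R t =>
    simp only [MetricSignature.Formula.eval, MetricSignature.Term.eval_comp_equiv N σ hfun, hrel]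
  | conn F φ ih => simp only [MetricSignature.Formula.eval, ih]
  | sup D φ ih =>
    simp only [MetricSignature.Formula.eval]
    refine ((σ.subtypeEquiv fun y => (hdom D y).symm).iSup_congr fun y => ?_).symm
    rw [Equiv.subtypeEquiv_apply, hsnoc, ih]
  | inf D φ ih =>
    simp only [MetricSignature.Formula.eval]
    refine ((σ.subtypeEquiv fun y => (hdom D y).symm).iInf_congr fun y => ?_).symm
    rw [Equiv.subtypeEquiv_apply, hsnoc, ih]

/-- A set whose distance function is the interpretation of a single formula is definable. -/
theorem MetricStructure.isDefinableOver_of_formula (N : MetricStructure.{u} L)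
    (A C : Set N.carrier) (hC : IsClosed C)
    (ψ : (L.withConstants A fun a => N.domainOf a).Formula 1)
    (h : ∀ x : N.carrier, Metric.infDist x C = ψ.eval (N.expand A) fun _ => x) :
    N.IsDefinableOver A C :=
  ⟨hC, fun N' _ x => ψ.eval N' x,
    fun _ ε hε => ⟨ψ, fun _ _ _ _ => by rw [sub_self, abs_zero]; exact hε⟩, h⟩

/-- Elements of the definable closure are fixed by all automorphisms of the expanded structure. -/
theorem MetricStructure.fixed_of_mem_dcl (N : MetricStructure.{u} L) (A : Set N.carrier)
    (σ : N.carrier ≃ N.carrier)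
    (hfun : ∀ f x, σ (N.func f x) = N.func f fun i => σ (x i))
    (hdist : ∀ x y, dist (σ x) (σ y) = dist x y)
    (hrel : ∀ R x, N.rel R (fun i => σ (x i)) = N.rel R x)
    (hdom : ∀ D x, σ x ∈ N.domain D ↔ x ∈ N.domain D)
    (hA : ∀ a ∈ A, σ a = a) {x : N.carrier} (hx : x ∈ N.dcl A) : σ x = x := by
  obtain ⟨-, φ, hφ, h⟩ := hx
  obtain ⟨D, hD⟩ := N.exists_domain x
  refine dist_le_zero.1 (le_of_forall_pos_le_add fun ε hε => ?_)
  obtain ⟨ψ, hψ⟩ := hφ (fun _ => D) (ε / 2) (half_pos hε)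
  have h1 := hψ (N.expand A) (MetricStructure.models_theory _) (fun _ => x) fun _ => hD
  have h2 := hψ (N.expand A) (MetricStructure.models_theory _) (fun _ => σ x)
    fun _ => (hdom D x).2 hD
  have h3 : ψ.eval (N.expand A) (fun _ => σ x) = ψ.eval (N.expand A) (fun _ => x) := by
    refine MetricSignature.Formula.eval_comp_equiv (N.expand A) σ ?_ hdist hrel hdom ψ fun _ => x
    rintro (f | a) y
    · exact hfun f y
    · exact hA a.1 a.2
  have e1 := h x
  have e2 := h (σ x)
  rw [Metric.infDist_singleton] at e1 e2
  rw [← e1, dist_self] at h1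
  rw [← e2, h3] at h2
  rw [abs_lt] at h1 h2
  linarith [h1.1, h1.2, h2.1, h2.2]

end Invariance

/-! ### A continuous modulus from compactness -/

/-- If `g` vanishes on the zero set of `P` in a compact set, then `g` is controlled by `P` through
a continuous function on that compact set. -/
theorem exists_continuous_modulus {X : Type*} [TopologicalSpace X] {K : Set X} (hK : IsCompact K)
    {P g : X → ℝ} (hP : ContinuousOn P K) (hg : ContinuousOn g K)
    (hP0 : ∀ x ∈ K, 0 ≤ P x) (hgP : ∀ x ∈ K, P x = 0 → g x ≤ 0) :
    ∃ α : C(ℝ, ℝ), α 0 = 0 ∧ ∀ x ∈ K, g x ≤ α (P x) := by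
  obtain ⟨C, hC⟩ := hK.bddAbove_image hg
  set D : ℝ := max C 1 with hD
  have hD1 : 0 < D := lt_max_of_lt_right one_pos
  have hgD : ∀ x ∈ K, g x ≤ D := fun x hx =>
    (hC (Set.mem_image_of_mem g hx)).trans (le_max_left _ _)
  have key : ∀ ε : ℝ, 0 < ε → ∃ δ : ℝ, 0 < δ ∧ ∀ x ∈ K, ε ≤ g x → δ ≤ P x := by
    intro ε hε
    have hK' : IsCompact (K ∩ g ⁻¹' Set.Ici ε) := by
      obtain ⟨t, ht, hKt⟩ := (continuousOn_iff_isClosed.1 hg) (Set.Ici ε) isClosed_Ici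
      rw [Set.inter_comm, hKt, Set.inter_comm]
      exact hK.inter_right ht
    rcases (K ∩ g ⁻¹' Set.Ici ε).eq_empty_or_nonempty with h | h
    · refine ⟨1, one_pos, fun x hx hgx => ?_⟩
      have : x ∈ K ∩ g ⁻¹' Set.Ici ε := ⟨hx, hgx⟩
      rw [h] at this
      exact this.elim
    · obtain ⟨x, hx, hmin⟩ := hK'.exists_isMinOn h (hP.mono Set.inter_subset_left)
      refine ⟨P x, (hP0 x hx.1).lt_of_ne fun h0 => ?_, fun y hy hgy => hmin ⟨hy, hgy⟩⟩
      have h1 := hgP x hx.1 h0.symm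
      have h2 : ε ≤ g x := hx.2
      linarith
  choose δ hδ hδP using fun n : ℕ => key (D * (1 / 2) ^ (n + 1)) (by positivity)
  have hsum : Summable fun n : ℕ => D * (1 / 2 : ℝ) ^ n := summable_geometric_two.mul_left D
  have hbound : ∀ (n : ℕ) (t : ℝ),
      ‖D * (1 / 2 : ℝ) ^ n * min 1 (|t| / δ n)‖ ≤ D * (1 / 2 : ℝ) ^ n := by
    intro n t
    have h0 : 0 ≤ min 1 (|t| / δ n) := le_min zero_le_one (div_nonneg (abs_nonneg t) (hδ n).le)
    rw [Real.norm_of_nonneg (by positivity)]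
    exact mul_le_of_le_one_right (by positivity) (min_le_left _ _)
  refine ⟨⟨fun t => ∑' n, D * (1 / 2 : ℝ) ^ n * min 1 (|t| / δ n), ?_⟩, ?_, fun x hx => ?_⟩
  · exact continuous_tsum (fun n => by fun_prop) hsum hbound
  · simp
  · rcases le_or_gt (g x) 0 with h | h
    · refine h.trans (tsum_nonneg fun n => ?_)
      have h0 : 0 ≤ min 1 (|P x| / δ n) :=
        le_min zero_le_one (div_nonneg (abs_nonneg _) (hδ n).le)
      positivity
    · -- the first dyadic scale below `g x` contributes a full summand
      obtain ⟨n, h1, h2⟩ := exists_nat_pow_near_of_lt_one (div_pos h hD1)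
        ((div_le_one hD1).2 (hgD x hx)) (y := (1 / 2 : ℝ)) (by norm_num) (by norm_num)
      have h3 := hδP n x hx (by rw [lt_div_iff₀ hD1] at h1; linarith)
      have h4 : g x ≤ D * (1 / 2 : ℝ) ^ n * min 1 (|P x| / δ n) := by
        rw [min_eq_left ((one_le_div (hδ n)).2 (h3.trans (le_abs_self _)))]
        rw [div_le_iff₀ hD1] at h2
        linarith
      refine h4.trans ?_
      refine (hsum.of_norm_bounded (hbound · (P x))).le_tsum n fun m _ => ?_
      have h0 : 0 ≤ min 1 (|P x| / δ m) :=
        le_min zero_le_one (div_nonneg (abs_nonneg _) (hδ m).le)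
      positivity

/-! ### Functions given by terms and formulas -/

section Definability

variable {M : Type u} [CStarAlgebra M] [FiniteDimensional ℂ M] (τ : FaithfulTrace M)
  (A : Set (trStructure τ).carrier)

/-- The language of tracial W*-algebras with constants for the elements of `A`. -/
noncomputable abbrev trSignatureOver (A : Set (trStructure τ).carrier) : MetricSignature.{u} :=
  trSignature.{u}.withConstants A fun a => (trStructure τ).domainOf a

/-- The function `t : M ^ n → M` is the interpretation of a term with constants from `A`. -/
def IsTermFun {n : ℕ} (t : (Fin n → M) → M) : Prop :=
  ∃ s : (trSignatureOver τ A).Term n,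
    ∀ x : Fin n → M, s.eval ((trStructure τ).expand A) x = t x

/-- The function `f : M ^ n → ℝ` is the interpretation of a formula with constants from `A`. -/
def IsFormulaFun {n : ℕ} (f : (Fin n → M) → ℝ) : Prop :=
  ∃ s : (trSignatureOver τ A).Formula n,
    ∀ x : Fin n → M, s.eval ((trStructure τ).expand A) x = f x

variable {τ A}

theorem IsTermFun.var {n : ℕ} (i : Fin n) : IsTermFun τ A fun x => x i :=
  ⟨.var i, fun _ => rfl⟩

theorem IsTermFun.const {n : ℕ} {a : M} (ha : a ∈ A) :
    IsTermFun τ A fun _ : Fin n → M => a :=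
  ⟨.func (.inr ⟨a, ha⟩) Fin.elim0, fun _ => rfl⟩

theorem IsTermFun.zero {n : ℕ} : IsTermFun τ A fun _ : Fin n → M => (0 : M) :=
  ⟨.func (.inl .zero) Fin.elim0, fun _ => rfl⟩

theorem IsTermFun.add {n : ℕ} {s t : (Fin n → M) → M} (hs : IsTermFun τ A s)
    (ht : IsTermFun τ A t) : IsTermFun τ A fun x => s x + t x := by
  obtain ⟨s', hs⟩ := hs
  obtain rfl := funext hs
  obtain ⟨t', ht⟩ := ht
  obtain rfl := funext ht
  refine ⟨.func (.inl .add) (fun i : Fin 2 => ![s', t'] i), fun _ => rfl⟩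

theorem IsTermFun.mul {n : ℕ} {s t : (Fin n → M) → M} (hs : IsTermFun τ A s)
    (ht : IsTermFun τ A t) : IsTermFun τ A fun x => s x * t x := by
  obtain ⟨s', hs⟩ := hs
  obtain rfl := funext hs
  obtain ⟨t', ht⟩ := ht
  obtain rfl := funext ht
  refine ⟨.func (.inl .mul) (fun i : Fin 2 => ![s', t'] i), fun _ => rfl⟩

theorem IsTermFun.star {n : ℕ} {s : (Fin n → M) → M} (hs : IsTermFun τ A s) :
    IsTermFun τ A fun x => star (s x) := by
  obtain ⟨s', hs⟩ := hs
  obtain rfl := funext hs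
  refine ⟨.func (.inl .star) (fun _ : Fin 1 => s'), fun _ => rfl⟩

theorem IsTermFun.smul {n : ℕ} {s : (Fin n → M) → M} (c : ℂ) (hs : IsTermFun τ A s) :
    IsTermFun τ A fun x => c • s x := by
  obtain ⟨s', hs⟩ := hs
  obtain rfl := funext hs
  refine ⟨.func (.inl (.smul c)) (fun _ : Fin 1 => s'), fun _ => rfl⟩

theorem IsTermFun.sum {n : ℕ} {ι : Type*} (S : Finset ι) {s : ι → (Fin n → M) → M}
    (hs : ∀ i, IsTermFun τ A (s i)) : IsTermFun τ A fun x => ∑ i ∈ S, s i x := by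
  classical
  induction S using Finset.induction_on with
  | empty => simpa using IsTermFun.zero
  | insert i S hi ih => simpa only [Finset.sum_insert hi] using (hs i).add ih

theorem IsFormulaFun.norm₂_sub {n : ℕ} {s t : (Fin n → M) → M} (hs : IsTermFun τ A s)
    (ht : IsTermFun τ A t) : IsFormulaFun τ A fun x => τ.norm₂ (s x - t x) := by
  obtain ⟨s', hs⟩ := hs
  obtain rfl := funext hs
  obtain ⟨t', ht⟩ := ht
  obtain rfl := funext ht
  refine ⟨.dist s' t', fun _ => rfl⟩

theorem IsFormulaFun.re_trace {n : ℕ} {s : (Fin n → M) → M} (hs : IsTermFun τ A s) :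
    IsFormulaFun τ A fun x => (τ (s x)).re := by
  obtain ⟨s', hs⟩ := hs
  obtain rfl := funext hs
  refine ⟨.rel .reTr (fun _ : Fin 1 => s'), fun _ => rfl⟩

theorem IsFormulaFun.im_trace {n : ℕ} {s : (Fin n → M) → M} (hs : IsTermFun τ A s) :
    IsFormulaFun τ A fun x => (τ (s x)).im := by
  obtain ⟨s', hs⟩ := hs
  obtain rfl := funext hs
  refine ⟨.rel .imTr (fun _ : Fin 1 => s'), fun _ => rfl⟩

theorem IsFormulaFun.comp {n : ℕ} {f : (Fin n → M) → ℝ} (F : C(ℝ, ℝ))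
    (hf : IsFormulaFun τ A f) : IsFormulaFun τ A fun x => F (f x) := by
  obtain ⟨f', hf⟩ := hf
  obtain rfl := funext hf
  refine ⟨.conn (m := 1) (F.comp ⟨fun v => v 0, by fun_prop⟩) (fun _ => f'), fun _ => rfl⟩

theorem IsFormulaFun.add {n : ℕ} {f g : (Fin n → M) → ℝ} (hf : IsFormulaFun τ A f)
    (hg : IsFormulaFun τ A g) : IsFormulaFun τ A fun x => f x + g x := by
  obtain ⟨f', hf⟩ := hf
  obtain rfl := funext hf
  obtain ⟨g', hg⟩ := hg
  obtain rfl := funext hg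
  refine ⟨.conn (m := 2) ⟨fun v => v 0 + v 1, by fun_prop⟩ ![f', g'], fun _ => rfl⟩

theorem IsFormulaFun.sum {n : ℕ} {ι : Type*} (S : Finset ι) {f : ι → (Fin n → M) → ℝ}
    (hf : ∀ i, IsFormulaFun τ A (f i)) : IsFormulaFun τ A fun x => ∑ i ∈ S, f i x := by
  classical
  induction S using Finset.induction_on with
  | empty =>
    have h : IsFormulaFun τ A fun _ : Fin n → M => (0 : ℝ) :=
      ⟨.conn (m := 0) ⟨fun _ => 0, by fun_prop⟩ Fin.elim0, fun _ => rfl⟩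
    simpa using h
  | insert i S hi ih => simpa only [Finset.sum_insert hi] using (hf i).add ih

theorem IsFormulaFun.iInf {n : ℕ} {f : (Fin (n + 1) → M) → ℝ} (R : {r : ℝ // 0 < r})
    (hf : IsFormulaFun τ A f) :
    IsFormulaFun τ A fun x => ⨅ y : {y : M // ‖y‖ ≤ R.1}, f (Fin.snoc x y.1) := by
  obtain ⟨f', hf⟩ := hf
  obtain rfl := funext hf
  refine ⟨.inf R f', fun _ => rfl⟩

/-- Iterated infima over a ball: if `h z` is the minimum of `w ↦ f (z, w)` over the tuples from a
ball, and this minimum is attained at a tuple that does not depend on `z`, then `h` is given by a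
formula if `f` is. -/
theorem IsFormulaFun.of_isLeast {n N : ℕ} {f : (Fin (n + N) → M) → ℝ} {h : (Fin n → M) → ℝ}
    (R : {r : ℝ // 0 < r}) (hf : IsFormulaFun τ A f)
    (hle : ∀ z (w : Fin N → M), (∀ i, ‖w i‖ ≤ R.1) → h z ≤ f (Fin.append z w))
    {b : Fin N → M} (hb : ∀ i, ‖b i‖ ≤ R.1) (heq : ∀ z, f (Fin.append z b) = h z) :
    IsFormulaFun τ A h := by
  induction N with
  | zero =>
    have : h = f := by
      funext z
      rw [← heq z, Subsingleton.elim b Fin.elim0, Fin.append_elim0]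
      rfl
    rw [this]
    exact hf
  | succ N ih =>
    have happ : ∀ (z : Fin n → M) (w : Fin N → M) (y : M),
        (Fin.snoc (Fin.append z w) y : Fin (n + N + 1) → M) = Fin.append z (Fin.snoc w y) :=
      fun z w y => (Fin.append_snoc z w y).symm
    have hs : ∀ (w : Fin N → M) (y : M), (∀ i, ‖w i‖ ≤ R.1) → ‖y‖ ≤ R.1 →
        ∀ i, ‖(Fin.snoc w y : Fin (N + 1) → M) i‖ ≤ R.1 := by
      intro w y hw hy i
      refine Fin.lastCases ?_ (fun i => ?_) i
      · rwa [Fin.snoc_last]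
      · rw [Fin.snoc_castSucc]
        exact hw i
    have hne : Nonempty {y : M // ‖y‖ ≤ R.1} := ⟨⟨0, by rw [norm_zero]; exact R.2.le⟩⟩
    have hlow : ∀ z (w : Fin N → M), (∀ i, ‖w i‖ ≤ R.1) →
        h z ≤ ⨅ y : {y : M // ‖y‖ ≤ R.1}, f (Fin.snoc (Fin.append z w) y.1) :=
      fun z w hw => le_ciInf fun y => by
        rw [happ]
        exact hle z _ (hs w y.1 hw y.2)
    have hbi : ∀ i, ‖Fin.init b i‖ ≤ R.1 := fun i => hb _
    refine ih (hf.iInf R) hlow hbi fun z => le_antisymm ?_ (hlow z _ hbi)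
    rw [← heq z]
    refine (ciInf_le ⟨h z, ?_⟩ ⟨b (Fin.last N), hb _⟩).trans (le_of_eq ?_)
    · rintro _ ⟨y, rfl⟩
      change h z ≤ f (Fin.snoc (Fin.append z (Fin.init b)) y.1)
      rw [happ]
      exact hle z _ (hs _ y.1 hbi y.2)
    · rw [happ, Fin.snoc_init_self]

theorem mem_dcl_of_isFormulaFun {x : M}
    (h : IsFormulaFun τ A fun z : Fin 1 → M => τ.norm₂ (z 0 - x)) :
    x ∈ (trStructure τ).dcl A := by
  obtain ⟨ψ, hψ⟩ := h
  refine MetricStructure.isDefinableOver_of_formula _ A _ isClosed_singleton ψ fun y => ?_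
  exact Metric.infDist_singleton.trans (hψ fun _ => y).symm

theorem FaithfulTrace.ball_isCompact₂ (τ : FaithfulTrace M) (r : ℝ) :
    @IsCompact M τ.metricSpace₂.toUniformSpace.toTopologicalSpace {x | ‖x‖ ≤ r} := by
  have : ProperSpace M := FiniteDimensional.proper ℂ M
  have hc : IsCompact {x : M | ‖x‖ ≤ r} := by
    convert isCompact_closedBall (0 : M) r using 1
    ext x; simp
  have hid : @Continuous M M _ τ.metricSpace₂.toUniformSpace.toTopologicalSpace id := by
    refine @LipschitzWith.continuous M M _ τ.metricSpace₂.toPseudoMetricSpace.toPseudoEMetricSpace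
      1 id (@LipschitzWith.of_dist_le_mul M M _ τ.metricSpace₂.toPseudoMetricSpace 1 id ?_)
    intro x y
    rw [NNReal.coe_one, one_mul, dist_eq_norm]
    exact τ.norm₂_le (x - y)
  simpa only [Set.image_id] using
    @IsCompact.image M M _ τ.metricSpace₂.toUniformSpace.toTopologicalSpace _ id hc hid

/-- Every element lies in a ball, and a ball is a definable compact set: the distance to it is an
infimum over a domain of quantification. -/
theorem acl_eq_univ : (trStructure τ).acl A = Set.univ := by
  refine Set.eq_univ_of_forall fun x => ?_
  obtain ⟨D, hD⟩ := (trStructure τ).exists_domain x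
  have hball : @IsCompact M τ.metricSpace₂.toUniformSpace.toTopologicalSpace {x | ‖x‖ ≤ D.1} :=
    τ.ball_isCompact₂ D.1
  have hvar : IsFormulaFun τ A fun z : Fin 2 → M => τ.norm₂ (z 0 - z 1) :=
    .norm₂_sub (.var 0) (.var 1)
  obtain ⟨ψ, hψ⟩ := hvar.iInf (n := 1) D
  refine ⟨D, (trStructure τ).domain D, subset_rfl, hD, hball,
    MetricStructure.isDefinableOver_of_formula _ A _
      (IsCompact.isClosed (X := (trStructure τ).carrier) hball) ψ fun y => ?_⟩
  exact Metric.infDist_eq_iInf.trans (hψ fun _ => y).symm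

end Definability

/-! ### The definable closure is the fixed-point algebra -/

section FixedPoints

variable {M : Type u} [CStarAlgebra M] (τ : FaithfulTrace M)

/-- The elements of `M` that are fixed by all trace preserving `*`-endomorphisms of `M` over `A`.
In finite dimension, these endomorphisms are automorphisms. -/
def traceFixedPoints (A : StarSubalgebra ℂ M) : Set M :=
  {x | ∀ σ : M →⋆ₐ[ℂ] M, (∀ y, τ (σ y) = τ y) → (∀ a ∈ A, σ a = a) → σ x = x}

theorem FaithfulTrace.eq_zero_of_norm₂_eq_zero {x : M} (h : τ.norm₂ x = 0) : x = 0 :=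
  τ.metricSpace₂.eq_of_dist_eq_zero (by
    change τ.norm₂ (x - 0) = 0
    rwa [sub_zero])

theorem FaithfulTrace.norm₂_map {σ : M →⋆ₐ[ℂ] M} (hσ : ∀ y, τ (σ y) = τ y) (x : M) :
    τ.norm₂ (σ x) = τ.norm₂ x := by
  unfold FaithfulTrace.norm₂
  rw [← StarHomClass.map_star σ, ← map_mul, hσ]

theorem FaithfulTrace.bijective_of_map [FiniteDimensional ℂ M] {σ : M →⋆ₐ[ℂ] M}
    (hσ : ∀ y, τ (σ y) = τ y) : Function.Bijective σ := by
  have hinj : Function.Injective σ := (injective_iff_map_eq_zero σ).2 fun x hx =>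
    τ.eq_zero_of_norm₂_eq_zero (by rw [← τ.norm₂_map hσ, hx, τ.norm₂_zero])
  exact ⟨hinj, LinearMap.surjective_of_injective (f := σ.toAlgHom.toLinearMap) hinj⟩

theorem FaithfulTrace.continuous_norm₂ [FiniteDimensional ℂ M] : Continuous τ.norm₂ := by
  have h : Continuous τ.toLinearMap := LinearMap.continuous_of_finiteDimensional _
  unfold FaithfulTrace.norm₂
  fun_prop

variable (A : StarSubalgebra ℂ M)

variable {ι : Type*} [Fintype ι] (b : Module.Basis ι ℂ M)

/-- The failure of the linear map with `b i ↦ w i` to be a trace preserving `*`-endomorphism that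
fixes the elements `c l`. -/
noncomputable def endDefect {κ : Type*} [Fintype κ] (c : κ → M) (w : ι → M) : ℝ :=
  (∑ i, ∑ j, τ.norm₂ (w i * w j - b.constr ℂ w (b i * b j))) +
  (∑ i, τ.norm₂ (star (w i) - b.constr ℂ w (star (b i)))) +
  (∑ i, |(τ (w i)).re - (τ (b i)).re|) + (∑ i, |(τ (w i)).im - (τ (b i)).im|) +
  ∑ l, τ.norm₂ (c l - b.constr ℂ w (c l))

variable {κ : Type*} [Fintype κ] {c : κ → M}

theorem endDefect_nonneg (w : ι → M) : 0 ≤ endDefect τ b c w := by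
  have h1 : ∀ i, 0 ≤ ∑ j, τ.norm₂ (w i * w j - b.constr ℂ w (b i * b j)) := fun i =>
    Finset.sum_nonneg fun j _ => τ.norm₂_nonneg _
  have h2 : ∀ i, 0 ≤ τ.norm₂ (star (w i) - b.constr ℂ w (star (b i))) := fun i => τ.norm₂_nonneg _
  have h3 : ∀ l, 0 ≤ τ.norm₂ (c l - b.constr ℂ w (c l)) := fun l => τ.norm₂_nonneg _
  have h1' := Finset.sum_nonneg fun i (_ : i ∈ Finset.univ) => h1 i
  have h2' := Finset.sum_nonneg fun i (_ : i ∈ Finset.univ) => h2 i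
  have h3' := Finset.sum_nonneg fun i (_ : i ∈ Finset.univ) => h3 i
  unfold endDefect
  positivity

theorem endDefect_self : endDefect τ b c b = 0 := by
  have h : b.constr ℂ b = LinearMap.id := b.ext fun i => b.constr_basis ℂ _ i
  simp [endDefect, h, τ.norm₂_zero]

theorem exists_starAlgHom_of_endDefect_eq_zero (hc : Submodule.span ℂ (Set.range c) =
    A.toSubalgebra.toSubmodule) {w : ι → M} (hw : endDefect τ b c w = 0) :
    ∃ σ : M →⋆ₐ[ℂ] M, (∀ y, τ (σ y) = τ y) ∧ (∀ a ∈ A, σ a = a) ∧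
      ∀ y, σ y = b.constr ℂ w y := by
  have n1 : ∀ i, 0 ≤ ∑ j, τ.norm₂ (w i * w j - b.constr ℂ w (b i * b j)) := fun i =>
    Finset.sum_nonneg fun j _ => τ.norm₂_nonneg _
  have n2 : ∀ i, 0 ≤ τ.norm₂ (star (w i) - b.constr ℂ w (star (b i))) := fun i => τ.norm₂_nonneg _
  have n3 : ∀ l, 0 ≤ τ.norm₂ (c l - b.constr ℂ w (c l)) := fun l => τ.norm₂_nonneg _
  have n1' := Finset.sum_nonneg fun i (_ : i ∈ Finset.univ) => n1 i
  have n2' := Finset.sum_nonneg fun i (_ : i ∈ Finset.univ) => n2 i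
  have n3' := Finset.sum_nonneg fun i (_ : i ∈ Finset.univ) => n3 i
  unfold endDefect at hw
  rw [add_eq_zero_iff_of_nonneg (by positivity) n3',
    add_eq_zero_iff_of_nonneg (by positivity) (by positivity),
    add_eq_zero_iff_of_nonneg (by positivity) (by positivity),
    add_eq_zero_iff_of_nonneg n1' n2',
    Finset.sum_eq_zero_iff_of_nonneg fun i _ => n1 i,
    Finset.sum_eq_zero_iff_of_nonneg fun i _ => n2 i,
    Finset.sum_eq_zero_iff_of_nonneg fun i _ => abs_nonneg _,
    Finset.sum_eq_zero_iff_of_nonneg fun i _ => abs_nonneg _,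
    Finset.sum_eq_zero_iff_of_nonneg fun i _ => n3 i] at hw
  obtain ⟨⟨⟨⟨h1, h2⟩, h3⟩, h4⟩, h5⟩ := hw
  have h0 : ∀ {x y : M}, τ.norm₂ (x - y) = 0 → x = y := fun h =>
    sub_eq_zero.1 (τ.eq_zero_of_norm₂_eq_zero h)
  have hTb : ∀ i, b.constr ℂ w (b i) = w i := fun i => b.constr_basis ℂ w i
  generalize b.constr ℂ w = T at *
  have hmul1 : ∀ i y, T (b i * y) = w i * T y := fun i =>
    LinearMap.congr_fun (f := T ∘ₗ LinearMap.mulLeft ℂ (b i)) (g := LinearMap.mulLeft ℂ (w i) ∘ₗ T)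
      (b.ext fun j => by
        have := h1 i (Finset.mem_univ i)
        rw [Finset.sum_eq_zero_iff_of_nonneg fun j _ => τ.norm₂_nonneg _] at this
        simpa [hTb] using (h0 (this j (Finset.mem_univ j))).symm)
  have hmul : ∀ x y, T (x * y) = T x * T y := fun x y =>
    LinearMap.congr_fun (f := T ∘ₗ LinearMap.mulRight ℂ y)
      (g := LinearMap.mulRight ℂ (T y) ∘ₗ T)
      (b.ext fun j => by simp [hTb, hmul1]) x
  have hstar : ∀ x, T x = star (T (star x)) :=
    LinearMap.congr_fun (f := T)
      (g := { toFun := fun x => star (T (star x))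
              map_add' := by simp
              map_smul' := by simp })
      (b.ext fun j => by
        have := h0 (h2 j (Finset.mem_univ j))
        simp [hTb, ← this])
  have htr : ∀ x, τ (T x) = τ x :=
    LinearMap.congr_fun (f := τ.toLinearMap ∘ₗ T) (g := τ.toLinearMap)
      (b.ext fun j => by
        have e1 := h3 j (Finset.mem_univ j)
        have e2 := h4 j (Finset.mem_univ j)
        rw [abs_eq_zero, sub_eq_zero] at e1 e2
        simp only [LinearMap.comp_apply, hTb]
        exact Complex.ext e1 e2)
  have hA : ∀ a ∈ A, T a = a := by
    intro a ha
    have ha' : a ∈ Submodule.span ℂ (Set.range c) := by rw [hc]; exact ha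
    exact LinearMap.eqOn_span (f := T) (g := LinearMap.id)
      (by rintro _ ⟨l, rfl⟩; exact (h0 (h5 l (Finset.mem_univ l))).symm) ha'
  have hone : T 1 = 1 := hA 1 (one_mem A)
  exact ⟨{ AlgHom.ofLinearMap T hone hmul with
    map_star' := fun x => by
      change T (star x) = star (T x)
      rw [hstar x, star_star] }, htr, hA, fun _ => rfl⟩

variable [FiniteDimensional ℂ M]

theorem dcl_subset_traceFixedPoints :
    traceFixedPoints τ A ⊇ (trStructure τ).dcl (A : Set M) := by
  intro (x : M) hx σ hσ hA
  let e : M ≃⋆ₐ[ℂ] M := StarAlgEquiv.ofBijective σ (τ.bijective_of_map hσ)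
  refine MetricStructure.fixed_of_mem_dcl (trStructure τ) (A : Set M) e.toEquiv ?_ ?_ ?_ ?_ hA hx
  · have hpoly : ∀ {d : ℕ} (p : FreeAlgebra ℂ (Fin d)) (y : Fin d → M),
        σ (FreeAlgebra.lift ℂ y p) = FreeAlgebra.lift ℂ (fun i => σ (y i)) p := fun p y =>
      DFunLike.congr_fun (f := σ.toAlgHom.comp (FreeAlgebra.lift ℂ y))
        (g := FreeAlgebra.lift ℂ fun i => σ (y i)) (by ext i; simp) p
    intro f y
    cases f with
    | add => exact map_add σ _ _
    | mul => exact map_mul σ _ _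
    | star => exact map_star σ _
    | smul c => exact map_smul σ c _
    | zero => exact map_zero σ
    | one => exact map_one σ
    | poly p n => exact hpoly p y
  · intro (y : M) (z : M)
    change τ.norm₂ (σ y - σ z) = τ.norm₂ (y - z)
    rw [← map_sub, τ.norm₂_map hσ]
  · intro R y
    cases R with
    | reTr => exact congrArg Complex.re (hσ _)
    | imTr => exact congrArg Complex.im (hσ _)
  · intro D (y : M)
    change ‖e y‖ ≤ D.1 ↔ ‖y‖ ≤ D.1
    rw [NonUnitalStarAlgHom.norm_map e (EquivLike.injective e)]

/-- An element `x` fixed by the trace preserving endomorphisms over `A` is definable: the type of a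
basis `b` of `M` over `A` is isolated by the vanishing of `endDefect`, and `x` is the value of a
term at every realization of this type. -/
theorem traceFixedPoints_subset_dcl :
    traceFixedPoints τ A ⊆ (trStructure τ).dcl (A : Set M) := by
  intro x hx
  let b := Module.finBasis ℂ M
  let a := Module.finBasis ℂ A.toSubalgebra.toSubmodule
  let c : Fin _ → M := fun l => (a l : M)
  have hc : Submodule.span ℂ (Set.range c) = A.toSubalgebra.toSubmodule := by
    have : Set.range c = A.toSubalgebra.toSubmodule.subtype '' Set.range a := by
      rw [← Set.range_comp]; rfl
    rw [this, Submodule.span_image, a.span_eq, Submodule.map_top, Submodule.range_subtype]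
  have hcA : ∀ l, c l ∈ (A : Set M) := fun l => (a l).2
  let R : {r : ℝ // 0 < r} := ⟨1 + ∑ i, ‖b i‖, by positivity⟩
  have hb : ∀ i, ‖b i‖ ≤ R.1 := fun i => by
    have := Finset.single_le_sum (f := fun i => ‖b i‖) (fun i _ => norm_nonneg _)
      (Finset.mem_univ i)
    change ‖b i‖ ≤ 1 + ∑ i, ‖b i‖
    linarith
  have : ProperSpace M := FiniteDimensional.proper ℂ M
  have hK : IsCompact (Set.univ.pi fun _ : Fin (Module.finrank ℂ M) =>
      Metric.closedBall (0 : M) R.1) := isCompact_univ_pi fun _ => isCompact_closedBall _ _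
  have hcont : ∀ y : M, Continuous fun w : Fin (Module.finrank ℂ M) → M => b.constr ℂ w y := by
    intro y
    simp only [Module.Basis.constr_apply_fintype]
    fun_prop
  have hn := τ.continuous_norm₂
  have ht : Continuous τ.toLinearMap := LinearMap.continuous_of_finiteDimensional _
  have hPc : Continuous (endDefect τ b c) := by
    unfold endDefect
    fun_prop
  have hgc : Continuous fun w : Fin (Module.finrank ℂ M) → M =>
      τ.norm₂ (b.constr ℂ w x - x) := by fun_prop
  obtain ⟨α, hα0, hα⟩ := exists_continuous_modulus hK hPc.continuousOn hgc.continuousOn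
    (fun w _ => endDefect_nonneg τ b w) fun w _ hw => by
      obtain ⟨σ, h1, h2, h3⟩ := exists_starAlgHom_of_endDefect_eq_zero τ A b hc hw
      rw [← h3, hx σ h1 h2, sub_self, τ.norm₂_zero]
  -- the tuple `w` occupies the variables after the first one
  let v : (Fin (1 + Module.finrank ℂ M) → M) → Fin (Module.finrank ℂ M) → M :=
    fun z i => z (Fin.natAdd 1 i)
  have hv : ∀ i, IsTermFun τ (A : Set M) fun z => v z i := fun i => .var _
  have hT : ∀ y, IsTermFun τ (A : Set M) fun z => b.constr ℂ (v z) y := by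
    intro y
    simp only [Module.Basis.constr_apply_fintype]
    exact .sum _ fun i => (hv i).smul _
  have habs : ∀ {f : (Fin (1 + Module.finrank ℂ M) → M) → ℝ} (r : ℝ),
      IsFormulaFun τ (A : Set M) f → IsFormulaFun τ (A : Set M) fun z => |f z - r| :=
    fun r hf => hf.comp ⟨fun t => |t - r|, by fun_prop⟩
  have hP : IsFormulaFun τ (A : Set M) fun z => endDefect τ b c (v z) := by
    unfold endDefect
    refine ((((IsFormulaFun.sum _ fun i => IsFormulaFun.sum _ fun j => ?_).add
      (IsFormulaFun.sum _ fun i => ?_)).add (IsFormulaFun.sum _ fun i => ?_)).add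
      (IsFormulaFun.sum _ fun i => ?_)).add (IsFormulaFun.sum _ fun l => ?_)
    · exact .norm₂_sub ((hv i).mul (hv j)) (hT _)
    · exact .norm₂_sub (hv i).star (hT _)
    · exact habs _ (.re_trace (hv i))
    · exact habs _ (.im_trace (hv i))
    · exact .norm₂_sub (.const (hcA l)) (hT _)
  have hF : IsFormulaFun τ (A : Set M) fun z =>
      τ.norm₂ (z (Fin.castAdd _ 0) - b.constr ℂ (v z) x) + α (endDefect τ b c (v z)) :=
    (IsFormulaFun.norm₂_sub (.var _) (hT x)).add (hP.comp α)
  have hvapp : ∀ (z : Fin 1 → M) w, v (Fin.append z w) = w := fun z w => by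
    funext i
    exact Fin.append_right z w i
  refine mem_dcl_of_isFormulaFun (hF.of_isLeast R (fun z w hw => ?_) hb fun z => ?_)
  · rw [hvapp, Fin.append_left]
    have h1 := hα w fun i _ => by simpa using hw i
    have h2 := τ.norm₂_add_le (z 0 - b.constr ℂ w x) (b.constr ℂ w x - x)
    rw [sub_add_sub_cancel] at h2
    linarith
  · have h : b.constr ℂ b = LinearMap.id := b.ext fun i => b.constr_basis ℂ _ i
    rw [hvapp, Fin.append_left, endDefect_self, hα0, add_zero, h, LinearMap.id_apply]

theorem traceFixedPoints_eq_dcl : traceFixedPoints τ A = (trStructure τ).dcl (A : Set M) :=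
  (traceFixedPoints_subset_dcl τ A).antisymm (dcl_subset_traceFixedPoints τ A)

end FixedPoints

/-! ### Central projections are fixed -/

section Central

variable {J : Type*} [DecidableEq J] {n : J → ℕ}

theorem Matrix.pi_central_idempotent_apply
    {c : (j : J) → Matrix (Fin (n j)) (Fin (n j)) ℂ} (hc : ∀ x, c * x = x * c) (hi : c * c = c)
    (j : J) : c j = 0 ∨ c j = 1 := by
  have hcomm : ∀ X : Matrix (Fin (n j)) (Fin (n j)) ℂ, Commute X (c j) := fun X => by
    have := congrFun (hc (Pi.single j X)) j
    rw [Pi.mul_apply, Pi.mul_apply, Pi.single_eq_same] at this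
    exact this.symm
  obtain ⟨r, hr⟩ := Matrix.mem_range_scalar_iff_commute_single'.2 fun i k =>
    hcomm (Matrix.single i k 1)
  rcases isEmpty_or_nonempty (Fin (n j)) with h | ⟨⟨i⟩⟩
  · exact Or.inl (Subsingleton.elim _ _)
  · have h2 : c j * c j = c j := congrFun hi j
    rw [← hr, ← map_mul] at h2
    have h3 : r * r = r := by simpa using congrFun (congrFun h2 i) i
    rcases IsIdempotentElem.iff_eq_zero_or_one.1 h3 with h | h
    · left; rw [← hr, h, map_zero]
    · right; rw [← hr, h, map_one]

/-- An automorphism of a direct sum of matrix algebras permutes the minimal central projections. -/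
theorem Matrix.exists_map_single_one
    (θ : ((j : J) → Matrix (Fin (n j)) (Fin (n j)) ℂ) ≃ₐ[ℂ]
      ((j : J) → Matrix (Fin (n j)) (Fin (n j)) ℂ)) (hn : ∀ j, 0 < n j) (j : J) :
    ∃ j', θ (Pi.single j 1) = Pi.single j' 1 := by
  have hcent : ∀ (θ : ((j : J) → Matrix (Fin (n j)) (Fin (n j)) ℂ) ≃ₐ[ℂ]
      ((j : J) → Matrix (Fin (n j)) (Fin (n j)) ℂ)) (j j' : J),
      θ (Pi.single j 1) j' = 0 ∨ θ (Pi.single j 1) j' = 1 := by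
    intro θ j
    refine Matrix.pi_central_idempotent_apply (fun x => ?_) ?_
    · have : (Pi.single j 1 : (j : J) → Matrix (Fin (n j)) (Fin (n j)) ℂ) * θ.symm x =
          θ.symm x * Pi.single j 1 := by
        funext i
        by_cases h : i = j
        · subst h; simp
        · simp [h]
      simpa using congrArg θ this
    · rw [← map_mul, ← Pi.single_mul, one_mul]
  have hne : ∀ j, (Pi.single j 1 : (j : J) → Matrix (Fin (n j)) (Fin (n j)) ℂ) ≠ 0 := by
    intro j h
    have : Nonempty (Fin (n j)) := ⟨⟨0, hn j⟩⟩
    have := congrFun h j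
    simp at this
  obtain ⟨j', hj'⟩ : ∃ j', θ (Pi.single j 1) j' ≠ 0 := by
    by_contra! h
    exact hne j ((map_eq_zero_iff θ θ.injective).1 (funext h))
  have h1 : θ (Pi.single j 1) j' = 1 := (hcent θ j j').resolve_left hj'
  -- the preimage of the `j'`-th projection is a central projection below the `j`-th one
  have h2 : θ.symm (Pi.single j' 1) * Pi.single j 1 = θ.symm (Pi.single j' 1) := by
    apply θ.injective
    rw [map_mul, θ.apply_symm_apply]
    funext i
    by_cases h : i = j'
    · subst h; simp [h1]
    · simp [h]
  have h3 : ∀ i, i ≠ j → θ.symm (Pi.single j' 1) i = 0 := fun i hi => by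
    have := congrFun h2 i
    simpa [hi] using this.symm
  have h4 : θ.symm (Pi.single j' 1) = Pi.single j 1 := by
    have h5 : θ.symm (Pi.single j' 1) j = 1 := by
      refine (hcent θ.symm j' j).resolve_left fun h0 => hne j' ?_
      refine (map_eq_zero_iff θ.symm θ.symm.injective).1 (funext fun i => ?_)
      by_cases h : i = j
      · subst h; exact h0
      · exact h3 i h
    funext i
    by_cases h : i = j
    · subst h; simp [h5]
    · simp [h, h3 i h]
  exact ⟨j', by rw [← h4, θ.apply_symm_apply]⟩

theorem Matrix.le_of_map_single_one
    (θ : ((j : J) → Matrix (Fin (n j)) (Fin (n j)) ℂ) ≃ₐ[ℂ]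
      ((j : J) → Matrix (Fin (n j)) (Fin (n j)) ℂ)) {j j' : J}
    (h : θ (Pi.single j 1) = Pi.single j' 1) : n j ≤ n j' := by
  let f : Matrix (Fin (n j)) (Fin (n j)) ℂ →ₗ[ℂ] Matrix (Fin (n j')) (Fin (n j')) ℂ :=
    LinearMap.proj j' ∘ₗ θ.toLinearMap ∘ₗ LinearMap.single ℂ
      (fun j => Matrix (Fin (n j)) (Fin (n j)) ℂ) j
  have hf : Function.Injective f := by
    refine (injective_iff_map_eq_zero f).2 fun X hX => ?_
    have h1 : θ (Pi.single j X) = Pi.single j' 1 * θ (Pi.single j X) := by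
      rw [← h, ← map_mul, ← Pi.single_mul, one_mul]
    have h2 : θ (Pi.single j X) = 0 := by
      funext i
      by_cases hi : i = j'
      · subst hi; exact hX
      · rw [h1]; simp [hi]
    have h3 := (map_eq_zero_iff θ θ.injective).1 h2
    simpa using congrFun h3 j
  have h1 := LinearMap.finrank_le_finrank_of_injective hf
  simp only [Module.finrank_matrix, Module.finrank_self, Fintype.card_fin, mul_one] at h1
  exact Nat.mul_self_le_mul_self_iff.1 h1

end Central

theorem Matrix.trace_submatrix_equiv {m n R : Type*} [Fintype m] [Fintype n] [AddCommMonoid R]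
    (X : Matrix n n R) (e : m ≃ n) : (X.submatrix e e).trace = X.trace :=
  e.sum_comp X.diag

namespace BlockDecomposition

variable {M : Type u} [CStarAlgebra M] {τ : FaithfulTrace M} {A : StarSubalgebra ℂ M}
  (B : BlockDecomposition τ A)

/-- The minimal central projection of the `j`-th block. -/
def blockProj (j : Fin B.J) : M := B.blocks.symm (Pi.single j 1)

theorem trace_blockProj_mul (j : Fin B.J) (x : M) :
    τ (B.blockProj j * x) = B.β j * ((B.blocks x j).trace / B.n j) := by
  rw [B.trace_eq, Finset.sum_eq_single j]
  · simp [blockProj]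
  · intro j' _ h
    simp [blockProj, h]
  · simp

theorem trace_blockProj (j : Fin B.J) : τ (B.blockProj j) = B.β j := by
  have h := B.trace_blockProj_mul j 1
  have hn : (B.n j : ℂ) ≠ 0 := Nat.cast_ne_zero.2 (B.n_pos j).ne'
  rw [mul_one] at h
  rw [h, map_one, Pi.one_apply, Matrix.trace_one, Fintype.card_fin, div_self hn, mul_one]

theorem star_blockProj_mul_self (j : Fin B.J) :
    star (B.blockProj j) * B.blockProj j = B.blockProj j := by
  apply EquivLike.injective B.blocks
  rw [map_mul, map_star, blockProj, B.blocks.apply_symm_apply]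
  funext i
  by_cases h : i = j
  · subst h; simp
  · simp [h]

theorem blockProj_ne_zero (j : Fin B.J) : B.blockProj j ≠ 0 := by
  intro h
  have : Nonempty (Fin (B.n j)) := ⟨⟨0, B.n_pos j⟩⟩
  have := congrFun ((map_eq_zero_iff B.blocks.symm (EquivLike.injective B.blocks.symm)).1 h) j
  simp at this

theorem β_ne_zero (j : Fin B.J) : (B.β j : ℂ) ≠ 0 := fun h =>
  B.blockProj_ne_zero j (τ.faithful _ (by rw [star_blockProj_mul_self, trace_blockProj, h]))

/-- The multiplicity `k i j` is the trace of the image of a minimal projection of the `i`-th block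
of `A` in the `j`-th block of `M`. -/
theorem trace_blocks_single (i : Fin B.I) (j : Fin B.J) :
    (B.blocks (B.subBlocks.symm (Pi.single i (Matrix.single ⟨0, B.m_pos i⟩ ⟨0, B.m_pos i⟩ 1)) : A)
      j).trace = B.k i j := by
  rw [B.inclusion_eq, Matrix.reindex_apply, Matrix.trace_submatrix_equiv,
    Matrix.trace_blockDiagonal', Fintype.sum_sigma, Finset.sum_eq_single i]
  · simp
  · intro i' _ h
    simp [h]
  · simp

theorem exists_map_blockProj {σ : M →⋆ₐ[ℂ] M} (hbij : Function.Bijective σ)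
    (hσ : ∀ y, τ (σ y) = τ y) (hA : ∀ a ∈ A, σ a = a) (j : Fin B.J) :
    ∃ j', σ (B.blockProj j) = B.blockProj j' ∧ B.blockSetoid j j' := by
  let e : M ≃⋆ₐ[ℂ] M := StarAlgEquiv.ofBijective σ hbij
  let θ := (B.blocks.symm.trans (e.trans B.blocks)).toAlgEquiv
  have hθ : ∀ x, θ x = B.blocks (σ (B.blocks.symm x)) := fun x => rfl
  obtain ⟨j', hj'⟩ := Matrix.exists_map_single_one θ B.n_pos j
  have hσj : σ (B.blockProj j) = B.blockProj j' := by
    apply EquivLike.injective B.blocks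
    rw [blockProj, ← hθ, hj', blockProj, B.blocks.apply_symm_apply]
  have hn : B.n j = B.n j' := by
    refine le_antisymm (Matrix.le_of_map_single_one θ hj')
      (Matrix.le_of_map_single_one θ.symm ?_)
    rw [← hj', θ.symm_apply_apply]
  have hβ : B.β j = B.β j' := by
    have := hσ (B.blockProj j)
    rw [hσj, trace_blockProj, trace_blockProj] at this
    exact_mod_cast this.symm
  refine ⟨j', hσj, hn, hβ, fun i => ?_⟩
  set a : A := B.subBlocks.symm (Pi.single i (Matrix.single ⟨0, B.m_pos i⟩ ⟨0, B.m_pos i⟩ 1))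
  have h := hσ (B.blockProj j * a)
  rw [map_mul, hσj, hA a a.2, trace_blockProj_mul, trace_blockProj_mul, trace_blocks_single,
    trace_blocks_single, hβ, hn] at h
  have hn0 : (B.n j' : ℂ) ≠ 0 := Nat.cast_ne_zero.2 (B.n_pos j').ne'
  have h' := mul_left_cancel₀ (B.β_ne_zero j') h
  rw [div_left_inj' hn0] at h'
  exact_mod_cast h'.symm

open Classical in
theorem proj_eq_sum (C : Set (Fin B.J)) :
    B.proj C = ∑ j, if j ∈ C then B.blockProj j else 0 := by
  apply EquivLike.injective B.blocks
  rw [proj, B.blocks.apply_symm_apply, map_sum]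
  funext j
  rw [Finset.sum_apply, Finset.sum_eq_single j]
  · split_ifs <;> simp [blockProj]
  · intro j' _ h
    split_ifs
    · simp [blockProj, h.symm]
    · simp
  · simp

theorem map_proj {σ : M →⋆ₐ[ℂ] M} (hbij : Function.Bijective σ)
    (hσ : ∀ y, τ (σ y) = τ y) (hA : ∀ a ∈ A, σ a = a) {C : Set (Fin B.J)}
    (hC : C ∈ B.blockSetoid.classes) : σ (B.proj C) = B.proj C := by
  classical
  choose π hπ hr using B.exists_map_blockProj hbij hσ hA
  have hinj : Function.Injective π := by
    intro j j' h
    have h1 : B.blockProj j = B.blockProj j' := hbij.1 (by rw [hπ, hπ, h])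
    by_contra hne
    have h2 := congrFun (EquivLike.injective B.blocks.symm h1) j
    have : Nonempty (Fin (B.n j)) := ⟨⟨0, B.n_pos j⟩⟩
    simp [hne] at h2
  have hmem : ∀ j, j ∈ C ↔ π j ∈ C := by
    obtain ⟨y, rfl⟩ := hC
    exact fun j => ⟨fun h => B.blockSetoid.trans (B.blockSetoid.symm (hr j)) h,
      fun h => B.blockSetoid.trans (hr j) h⟩
  rw [proj_eq_sum, map_sum]
  conv_rhs => rw [← Equiv.sum_comp (Equiv.ofBijective π (Finite.injective_iff_bijective.1 hinj))]
  refine Finset.sum_congr rfl fun j _ => ?_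
  simp only [Equiv.ofBijective_apply, ← hmem]
  split_ifs
  · exact hπ j
  · exact map_zero σ

theorem span_subset_traceFixedPoints [FiniteDimensional ℂ M] :
    (Submodule.span ℂ {x : M | ∃ C ∈ B.blockSetoid.classes, ∃ a ∈ A, x = B.proj C * a} : Set M) ⊆
      traceFixedPoints τ A := by
  intro x hx σ hσ hA
  refine LinearMap.eqOn_span (f := σ.toAlgHom.toLinearMap) (g := LinearMap.id) ?_ hx
  rintro _ ⟨C, hC, a, ha, rfl⟩
  change σ (B.proj C * a) = B.proj C * a
  rw [map_mul, B.map_proj (τ.bijective_of_map hσ) hσ hA hC, hA a ha]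

end BlockDecomposition

/-! ### Fixed points lie in the span -/

namespace BlockDecomposition

variable {M : Type u} [CStarAlgebra M] {τ : FaithfulTrace M} {A : StarSubalgebra ℂ M}
  (B : BlockDecomposition τ A)

/-- The bijection of row indices that permutes the diagonal blocks by `g`. -/
def rowEquiv {j j' : Fin B.J} (g : ∀ i, Fin (B.k i j) ≃ Fin (B.k i j')) :
    (Σ p : (Σ i : Fin B.I, Fin (B.k i j)), Fin (B.m p.1)) ≃
      (Σ p : (Σ i : Fin B.I, Fin (B.k i j')), Fin (B.m p.1)) where
  toFun r := ⟨⟨r.1.1, g r.1.1 r.1.2⟩, r.2⟩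
  invFun r := ⟨⟨r.1.1, (g r.1.1).symm r.1.2⟩, r.2⟩
  left_inv := by rintro ⟨⟨i, l⟩, t⟩; simp
  right_inv := by rintro ⟨⟨i, l⟩, t⟩; simp

end BlockDecomposition

/-- The transposition of two elements of `Fin K` that are given as natural numbers; it is the
identity if they are not both below `K`. -/
def Fin.natSwap (K a b : ℕ) : Equiv.Perm (Fin K) :=
  if h : a < K ∧ b < K then Equiv.swap ⟨a, h.1⟩ ⟨b, h.2⟩ else 1

/-- Permutation of the blocks of a direct sum of matrix algebras by `s`, with an identification of
the rows by `e`, followed by conjugation with diagonal matrices with the entries `d`. -/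
def Matrix.piPermConj {J : Type*} {n : J → ℕ} (s : J → J) (e : ∀ j, Fin (n j) ≃ Fin (n (s j)))
    (d : ∀ j, Fin (n j) → ℂ) (hd : ∀ j r, d j r = 1 ∨ d j r = -1) :
    ((j : J) → Matrix (Fin (n j)) (Fin (n j)) ℂ) →⋆ₐ[ℂ]
      ((j : J) → Matrix (Fin (n j)) (Fin (n j)) ℂ) :=
  have hdd : ∀ j, Matrix.diagonal (d j) * Matrix.diagonal (d j) = 1 := fun j => by
    rw [Matrix.diagonal_mul_diagonal, ← Matrix.diagonal_one]
    congr 1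
    funext r
    rcases hd j r with h | h <;> simp [h]
  have hstar : ∀ j, star (Matrix.diagonal (d j)) = Matrix.diagonal (d j) := fun j => by
    rw [Matrix.star_eq_conjTranspose, Matrix.diagonal_conjTranspose]
    congr 1
    funext r
    rcases hd j r with h | h <;> simp [h]
  { toFun := fun X j =>
      Matrix.diagonal (d j) * (X (s j)).submatrix (e j) (e j) * Matrix.diagonal (d j)
    map_one' := by
      funext j
      simp [Matrix.submatrix_one_equiv, hdd]
    map_mul' := fun X Y => by
      funext j
      rw [Pi.mul_apply, Pi.mul_apply, ← Matrix.submatrix_mul_equiv _ _ _ (e j)]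
      have := hdd j
      generalize Matrix.diagonal (d j) = D at *
      calc _ = D * (X (s j)).submatrix (e j) (e j) * 1 * (Y (s j)).submatrix (e j) (e j) * D := by
            noncomm_ring
        _ = _ := by rw [← this]; noncomm_ring
    map_zero' := by
      funext j
      simp
    map_add' := fun X Y => by
      funext j
      change Matrix.diagonal (d j) * ((X (s j)).submatrix (e j) (e j) +
        (Y (s j)).submatrix (e j) (e j)) * Matrix.diagonal (d j) = _
      rw [mul_add, add_mul]
      rfl
    commutes' := fun r => by
      funext j
      rw [Algebra.algebraMap_eq_smul_one, Pi.smul_apply, Pi.smul_apply]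
      change Matrix.diagonal (d j) * (r • (1 : Matrix (Fin (n (s j))) (Fin (n (s j))) ℂ).submatrix
        (e j) (e j)) * Matrix.diagonal (d j) = _
      rw [Matrix.submatrix_one_equiv, mul_smul_comm, smul_mul_assoc, mul_one, hdd]
      rfl
    map_star' := fun X => by
      funext j
      simp only [Pi.star_apply, star_mul, hstar, ← mul_assoc]
      rfl }

theorem Matrix.piPermConj_apply {J : Type*} {n : J → ℕ} (s : J → J)
    (e : ∀ j, Fin (n j) ≃ Fin (n (s j)))
    (d : ∀ j, Fin (n j) → ℂ) (hd : ∀ j r, d j r = 1 ∨ d j r = -1)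
    (X : (j : J) → Matrix (Fin (n j)) (Fin (n j)) ℂ) (j : J) (r r' : Fin (n j)) :
    Matrix.piPermConj s e d hd X j r r' = d j r * X (s j) (e j r) (e j r') * d j r' := by
  change (Matrix.diagonal (d j) * (X (s j)).submatrix (e j) (e j) * Matrix.diagonal (d j)) r r' = _
  rw [Matrix.mul_diagonal, Matrix.diagonal_mul, Matrix.submatrix_apply]

namespace BlockDecomposition

variable {M : Type u} [CStarAlgebra M] {τ : FaithfulTrace M} {A : StarSubalgebra ℂ M}
  (B : BlockDecomposition τ A)

/-- The entries of the `j`-th block of `x` in the coordinates that are adapted to `A`. -/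
def entry (x : M) (j : Fin B.J) (r r' : Σ p : (Σ i : Fin B.I, Fin (B.k i j)), Fin (B.m p.1)) : ℂ :=
  B.blocks x j (B.coord j r) (B.coord j r')

theorem entry_eq (a : A) (j : Fin B.J) (i : Fin B.I) (l : Fin (B.k i j)) (t t' : Fin (B.m i)) :
    B.entry a j ⟨⟨i, l⟩, t⟩ ⟨⟨i, l⟩, t'⟩ = B.subBlocks a i t t' := by
  rw [entry, B.inclusion_eq, Matrix.reindex_apply, Matrix.submatrix_apply,
    Equiv.symm_apply_apply, Equiv.symm_apply_apply, Matrix.blockDiagonal'_apply_eq]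

theorem entry_ne (a : A) (j : Fin B.J) {r r'} (h : r.1 ≠ r'.1) : B.entry a j r r' = 0 := by
  rw [entry, B.inclusion_eq, Matrix.reindex_apply, Matrix.submatrix_apply,
    Equiv.symm_apply_apply, Equiv.symm_apply_apply, Matrix.blockDiagonal'_apply, dif_neg h]

/-- Invariance of the entries of a fixed point under permutations of equivalent blocks and of the
copies of the blocks of `A`, and under sign changes of these copies. -/
theorem entry_eq_of_mem {x : M} (hx : x ∈ traceFixedPoints τ A) (s : Equiv.Perm (Fin B.J))
    (hs : ∀ j, B.β (s j) = B.β j) (g : ∀ i j, Fin (B.k i j) ≃ Fin (B.k i (s j)))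
    (d : ∀ j, (Σ i : Fin B.I, Fin (B.k i j)) → ℂ) (hd : ∀ j p, d j p = 1 ∨ d j p = -1)
    (j : Fin B.J) (r r' : Σ p : (Σ i : Fin B.I, Fin (B.k i j)), Fin (B.m p.1)) :
    B.entry x j r r' = d j r.1 * B.entry x (s j) (B.rowEquiv (fun i => g i j) r)
      (B.rowEquiv (fun i => g i j) r') * d j r'.1 := by
  let e : ∀ j, Fin (B.n j) ≃ Fin (B.n (s j)) := fun j =>
    (B.coord j).symm.trans ((B.rowEquiv fun i => g i j).trans (B.coord (s j)))
  let θ := Matrix.piPermConj s e (fun j r => d j ((B.coord j).symm r).1) fun j r => hd j _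
  let σ : M →⋆ₐ[ℂ] M :=
    (B.blocks.symm.toStarAlgHom.comp θ).comp B.blocks.toStarAlgHom
  have hσ : ∀ y, B.blocks (σ y) = θ (B.blocks y) := fun y => B.blocks.apply_symm_apply _
  have hentry : ∀ y j r r', B.entry (σ y) j r r' = d j r.1 *
      B.entry y (s j) (B.rowEquiv (fun i => g i j) r) (B.rowEquiv (fun i => g i j) r') *
        d j r'.1 := by
    intro y j r r'
    rw [entry, hσ, Matrix.piPermConj_apply]
    simp [e, entry]
  rw [← hentry, hx σ]
  · intro y
    rw [B.trace_eq, B.trace_eq, hσ]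
    conv_rhs => rw [← Equiv.sum_comp s]
    refine Finset.sum_congr rfl fun j _ => ?_
    have hn : (B.n (s j) : ℂ) = B.n j := congrArg Nat.cast (Fin.equiv_iff_eq.1 ⟨e j⟩).symm
    have htr : (θ (B.blocks y) j).trace = (B.blocks y (s j)).trace := by
      rw [← Matrix.trace_submatrix_equiv (B.blocks y (s j)) (e j)]
      refine Finset.sum_congr rfl fun r _ => ?_
      rw [Matrix.diag_apply, Matrix.piPermConj_apply, Matrix.diag_apply, Matrix.submatrix_apply]
      rcases hd j ((B.coord j).symm r).1 with h | h <;> simp [h]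
    rw [htr, hs, hn]
  · intro a ha
    apply EquivLike.injective B.blocks
    have key : ∀ j r r', B.entry (σ a) j r r' = B.entry a j r r' := by
      rintro j ⟨⟨i, l⟩, t⟩ ⟨⟨i', l'⟩, t'⟩
      rw [hentry]
      by_cases h : (⟨i, l⟩ : Σ i : Fin B.I, Fin (B.k i j)) = ⟨i', l'⟩
      · cases h
        have h1 := B.entry_eq ⟨a, ha⟩ j i l t t'
        have h2 := B.entry_eq ⟨a, ha⟩ (s j) i (g i j l) t t'
        change d j ⟨i, l⟩ * B.entry a (s j) ⟨⟨i, g i j l⟩, t⟩ ⟨⟨i, g i j l⟩, t'⟩ * d j ⟨i, l⟩ = _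
        rw [h1, h2]
        rcases hd j ⟨i, l⟩ with h | h <;> simp [h]
      · have h1 := B.entry_ne ⟨a, ha⟩ j (r := ⟨⟨i, l⟩, t⟩) (r' := ⟨⟨i', l'⟩, t'⟩) h
        have h2 := B.entry_ne ⟨a, ha⟩ (s j) (r := ⟨⟨i, g i j l⟩, t⟩)
          (r' := ⟨⟨i', g i' j l'⟩, t'⟩) fun h' => h (by
            obtain rfl := congrArg Sigma.fst h'
            simpa using h')
        change d j ⟨i, l⟩ * B.entry a (s j) ⟨⟨i, g i j l⟩, t⟩ ⟨⟨i', g i' j l'⟩, t'⟩ *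
          d j ⟨i', l'⟩ = _
        rw [h1, h2]
        simp
    funext j
    ext r r'
    have := key j ((B.coord j).symm r) ((B.coord j).symm r')
    simpa [entry] using this

/-- The sign change of a single copy of a block of `A` negates the entries between this copy and the
others. -/
theorem entry_eq_zero_of_mem {x : M} (hx : x ∈ traceFixedPoints τ A) (j : Fin B.J)
    {r r' : Σ p : (Σ i : Fin B.I, Fin (B.k i j)), Fin (B.m p.1)} (h : r.1 ≠ r'.1) :
    B.entry x j r r' = 0 := by
  classical
  have := B.entry_eq_of_mem hx 1 (fun _ => rfl) (fun _ _ => Equiv.refl _)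
    (fun j' p => if (⟨j', p⟩ : Σ j, Σ i : Fin B.I, Fin (B.k i j)) = ⟨j, r.1⟩ then -1 else 1)
    (fun j' p => by split_ifs <;> simp) j r r'
  rw [if_pos rfl, if_neg (by simpa using h.symm)] at this
  change B.entry x j r r' = -1 * B.entry x j r r' * 1 at this
  linear_combination this / 2

theorem entry_eq_entry_copy {x : M} (hx : x ∈ traceFixedPoints τ A) (j : Fin B.J) (i : Fin B.I)
    (l l' : Fin (B.k i j)) (t t' : Fin (B.m i)) :
    B.entry x j ⟨⟨i, l⟩, t⟩ ⟨⟨i, l⟩, t'⟩ = B.entry x j ⟨⟨i, l'⟩, t⟩ ⟨⟨i, l'⟩, t'⟩ := by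
  have := B.entry_eq_of_mem hx 1 (fun _ => rfl) (fun _ _ => Fin.natSwap _ l l')
    (fun _ _ => 1) (fun _ _ => Or.inl rfl) j ⟨⟨i, l⟩, t⟩ ⟨⟨i, l⟩, t'⟩
  rw [one_mul, mul_one] at this
  have hl : Fin.natSwap (B.k i j) l l' l = l' := by
    rw [Fin.natSwap, dif_pos ⟨l.2, l'.2⟩, Equiv.swap_apply_left]
  rw [this]
  change B.entry x j ⟨⟨i, Fin.natSwap (B.k i j) l l' l⟩, t⟩
    ⟨⟨i, Fin.natSwap (B.k i j) l l' l⟩, t'⟩ = _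
  rw [hl]

/-- Transposing the blocks `j` and `j'` matches a copy in one with the equally numbered copy in the
other, and within a block all copies carry the same entries. -/
theorem entry_eq_entry_block {x : M} (hx : x ∈ traceFixedPoints τ A) {j j' : Fin B.J}
    (h : B.blockSetoid j j') (i : Fin B.I) (l : Fin (B.k i j)) (l' : Fin (B.k i j'))
    (t t' : Fin (B.m i)) :
    B.entry x j ⟨⟨i, l⟩, t⟩ ⟨⟨i, l⟩, t'⟩ = B.entry x j' ⟨⟨i, l'⟩, t⟩ ⟨⟨i, l'⟩, t'⟩ := by
  have hswap : ∀ j₁, B.blockSetoid (Equiv.swap j j' j₁) j₁ := by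
    intro j₁
    rw [Equiv.swap_apply_def]
    split_ifs with h1 h2
    · rw [h1]; exact B.blockSetoid.symm h
    · rw [h2]; exact h
    · exact B.blockSetoid.refl _
  have := B.entry_eq_of_mem hx (Equiv.swap j j') (fun j₁ => (hswap j₁).2.1)
    (fun i j₁ => finCongr ((hswap j₁).2.2 i).symm)
    (fun _ _ => 1) (fun _ _ => Or.inl rfl) j ⟨⟨i, l⟩, t⟩ ⟨⟨i, l⟩, t'⟩
  rw [one_mul, mul_one] at this
  rw [this]
  have h2 : ∀ (j₁ : Fin B.J) (l₁ : Fin (B.k i j₁)), j₁ = j' →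
      B.entry x j₁ ⟨⟨i, l₁⟩, t⟩ ⟨⟨i, l₁⟩, t'⟩ = B.entry x j' ⟨⟨i, l'⟩, t⟩ ⟨⟨i, l'⟩, t'⟩ := by
    rintro _ l₁ rfl
    exact B.entry_eq_entry_copy hx _ i l₁ l' t t'
  exact h2 _ _ (Equiv.swap_apply_left j j')

theorem traceFixedPoints_subset_span :
    traceFixedPoints τ A ⊆
      (Submodule.span ℂ {x : M | ∃ C ∈ B.blockSetoid.classes, ∃ a ∈ A, x = B.proj C * a} :
        Set M) := by
  classical
  intro x hx
  -- the matrices of the element of `A` that represents `x` on a class of blocks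
  let a : Quotient B.blockSetoid → A := fun q => B.subBlocks.symm fun i => Matrix.of fun t t' =>
    if h : 0 < B.k i q.out then B.entry x q.out ⟨⟨i, ⟨0, h⟩⟩, t⟩ ⟨⟨i, ⟨0, h⟩⟩, t'⟩ else 0
  have hsum : x = ∑ q : Quotient B.blockSetoid, B.proj {j | (⟦j⟧ : Quotient B.blockSetoid) = q} *
      (a q : M) := by
    apply EquivLike.injective B.blocks
    rw [map_sum]
    funext j
    rw [Finset.sum_apply, Finset.sum_eq_single ⟦j⟧]
    · rw [map_mul, Pi.mul_apply, proj, B.blocks.apply_symm_apply]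
      simp only [Set.mem_ofPred_eq, if_true, one_mul]
      have hout : B.blockSetoid j (Quotient.out ⟦j⟧) := B.blockSetoid.symm (Quotient.mk_out j)
      have key : ∀ r r', B.entry x j r r' = B.entry (a ⟦j⟧) j r r' := by
        rintro ⟨⟨i, l⟩, t⟩ ⟨⟨i', l'⟩, t'⟩
        by_cases h : (⟨i, l⟩ : Σ i : Fin B.I, Fin (B.k i j)) = ⟨i', l'⟩
        · cases h
          have h0 : 0 < B.k i (Quotient.out (⟦j⟧ : Quotient B.blockSetoid)) := by
            rw [← hout.2.2 i]; exact l.pos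
          rw [B.entry_eq, B.subBlocks.apply_symm_apply, Matrix.of_apply, dif_pos h0]
          exact B.entry_eq_entry_block hx hout i l _ t t'
        · rw [B.entry_ne _ _ h, B.entry_eq_zero_of_mem hx _ h]
      ext r r'
      simpa [entry] using key ((B.coord j).symm r) ((B.coord j).symm r')
    · intro q _ hq
      rw [map_mul, Pi.mul_apply, proj, B.blocks.apply_symm_apply]
      simp [hq.symm]
    · simp
  rw [hsum]
  refine Submodule.sum_mem _ fun q _ => Submodule.subset_span ⟨_, ?_, a q, (a q).2, rfl⟩
  refine ⟨q.out, ?_⟩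
  ext j
  simp only [Set.mem_ofPred_eq]
  rw [← Quotient.eq (r := B.blockSetoid), Quotient.out_eq]

end BlockDecomposition

/-! ### Finite-dimensional `*`-algebras with a faithful positive functional -/

section Wedderburn

/-- A finite-dimensional algebra with a proper involution is semisimple: a selfadjoint element
`star x * x` of the nilpotent Jacobson radical vanishes. -/
theorem isSemisimpleRing_of_star_mul_self_eq_zero {M : Type*} [Ring M] [StarRing M] [Algebra ℂ M]
    [FiniteDimensional ℂ M] (h : ∀ x : M, star x * x = 0 → x = 0) : IsSemisimpleRing M := by
  have := IsArtinianRing.of_finite ℂ M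
  rw [IsArtinianRing.isSemisimpleRing_iff_jacobson, eq_bot_iff]
  intro x hx
  obtain ⟨N, hN⟩ := IsSemiprimaryRing.isNilpotent (R := M)
  have hself : ∀ (k : ℕ) (y : M), star y = y → y ^ 2 ^ k = 0 → y = 0 := by
    intro k
    induction k with
    | zero => intro y _ hy; simpa using hy
    | succ k ih =>
      intro y hy hk
      refine ih y hy (h _ ?_)
      rwa [star_pow, hy, ← pow_add, ← two_mul, ← pow_succ']
  have hy : (star x * x) ^ N = 0 := by
    have := Ideal.pow_mem_pow (Ideal.mul_mem_left (Ring.jacobson M) (star x) hx) N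
    rwa [hN] at this
  exact h x (hself N _ (by simp) (by
    rw [← Nat.add_sub_cancel' (Nat.lt_two_pow_self (n := N)).le, pow_add, hy, zero_mul]))

/-- The `*`-algebra version of the Wedderburn–Artin theorem. An algebra isomorphism from `M` to a
sum of matrix algebras makes every column space `ℂⁿ` an `M`-module that embeds in `M`, so the
functional induces an inner product on it; in an orthonormal basis for this inner product, `M`
acts by a `*`-representation. -/
theorem exists_starAlgEquiv_pi_matrix {M : Type*} [Ring M] [StarRing M] [Algebra ℂ M]
    [StarModule ℂ M] [FiniteDimensional ℂ M] (φ : M →ₗ[ℂ] ℂ)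
    (hstar : ∀ x, φ (star x) = starRingEnd ℂ (φ x)) (hpos : ∀ x, 0 ≤ φ (star x * x))
    (hfaith : ∀ x, φ (star x * x) = 0 → x = 0) :
    ∃ (J : ℕ) (n : Fin J → ℕ), (∀ j, 0 < n j) ∧
      Nonempty (M ≃⋆ₐ[ℂ] ((j : Fin J) → Matrix (Fin (n j)) (Fin (n j)) ℂ)) := by
  have : IsSemisimpleRing M := isSemisimpleRing_of_star_mul_self_eq_zero fun x hx =>
    hfaith x (by rw [hx, map_zero])
  obtain ⟨J, n, hn, ⟨Φ⟩⟩ := IsSemisimpleRing.exists_algEquiv_pi_matrix_of_isAlgClosed ℂ M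
  refine ⟨J, n, fun j => (hn j).pos, ?_⟩
  -- `v j r` is the `r`-th unit vector in the first column of the `j`-th block
  let v : ∀ j, Fin (n j) → M := fun j r =>
    Φ.symm (Pi.single j (Matrix.single r (0 : Fin (n j)) 1))
  have hv : ∀ x j s, x * v j s = ∑ r, Φ x j r s • v j r := by
    intro x j s
    apply Φ.injective
    simp only [map_mul, map_sum, map_smul, v, AlgEquiv.apply_symm_apply]
    funext i
    rw [Finset.sum_apply]
    by_cases h : i = j
    · subst h
      simp only [Pi.mul_apply, Pi.smul_apply, Pi.single_eq_same]
      ext a b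
      simp [Matrix.mul_apply, Matrix.sum_apply, Matrix.single_apply, ite_and]
    · simp [h]
  have hlin : ∀ j (c : Fin (n j) → ℂ), ∑ r, c r • v j r = 0 → c = 0 := by
    intro j c hc
    have h := congrFun (congrArg Φ hc) j
    simp only [map_sum, map_smul, v, AlgEquiv.apply_symm_apply, Finset.sum_apply, Pi.smul_apply,
      Pi.single_eq_same, map_zero, Pi.zero_apply] at h
    funext a
    have := congrFun (congrFun h a) 0
    simpa [Matrix.sum_apply, Matrix.single_apply] using this
  let H : (j : Fin J) → Matrix (Fin (n j)) (Fin (n j)) ℂ := fun j =>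
    Matrix.of fun r s => φ (star (v j r) * v j s)
  have hH : ∀ j, (H j).PosDef := by
    intro j
    refine .of_dotProduct_mulVec_pos ?_ fun c hc => ?_
    · ext r s
      simp only [H, Matrix.conjTranspose_apply, Matrix.of_apply]
      rw [← starRingEnd_apply, ← hstar, star_mul, star_star]
    · have h : dotProduct (star c) ((H j).mulVec c) =
          φ (star (∑ r, c r • v j r) * ∑ r, c r • v j r) := by
        rw [star_sum, Finset.sum_mul_sum]
        simp only [star_smul, smul_mul_smul_comm, map_sum, map_smul, dotProduct, Matrix.mulVec,
          Finset.mul_sum, Pi.star_apply, H, Matrix.of_apply, smul_eq_mul]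
        exact Finset.sum_congr rfl fun r _ => Finset.sum_congr rfl fun s _ => by ring
      rw [h]
      exact (hpos _).lt_of_ne fun h0 => hc (hlin j c (hfaith _ h0.symm))
  have hS : ∀ j, ∃ S : (Matrix (Fin (n j)) (Fin (n j)) ℂ)ˣ,
      H j = star (S : Matrix (Fin (n j)) (Fin (n j)) ℂ) * S := by
    intro j
    open scoped MatrixOrder Matrix.Norms.L2Operator in
    obtain ⟨S, hS⟩ := CStarAlgebra.nonneg_iff_eq_star_mul_self.1 (hH j).posSemidef.nonneg
    have hu := (hH j).isUnit
    rw [hS, Matrix.isUnit_iff_isUnit_det, Matrix.det_mul] at hu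
    exact ⟨((Matrix.isUnit_iff_isUnit_det S).2 (isUnit_of_mul_isUnit_right hu)).unit, hS⟩
  choose S hS using hS
  have hcomm : ∀ x j, H j * Φ (star x) j = star (Φ x j) * H j := by
    intro x j
    ext r s
    have h1 : star (v j r) * (star x * v j s) = star (x * v j r) * v j s := by
      rw [star_mul, mul_assoc]
    rw [hv (star x) j s, hv x j r] at h1
    have h2 := congrArg φ h1
    simp only [Finset.mul_sum, star_sum, Finset.sum_mul, star_smul, mul_smul_comm, smul_mul_assoc,
      map_sum, map_smul, smul_eq_mul] at h2
    simp only [Matrix.mul_apply, H, Matrix.of_apply, Matrix.star_apply]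
    rw [← h2]
    exact Finset.sum_congr rfl fun q _ => mul_comm _ _
  let U : ((j : Fin J) → Matrix (Fin (n j)) (Fin (n j)) ℂ)ˣ := MulEquiv.piUnits.symm S
  let Ψ := Φ.trans (MulSemiringAction.toAlgEquiv ℂ _ (ConjAct.toConjAct U))
  have hΨ : ∀ x j, Ψ x j = (S j).1 * Φ x j * ((S j)⁻¹).1 :=
    fun x j => rfl
  refine ⟨StarAlgEquiv.ofAlgEquiv Ψ fun x => funext fun j => ?_⟩
  have h := hcomm x j
  rw [hS] at h
  rw [Pi.star_apply, hΨ, hΨ, star_mul, star_mul]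
  have hinv : star ((S j)⁻¹).1 * star (S j).1 = 1 := by
    rw [← star_mul, Units.mul_inv, star_one]
  calc (S j).1 * Φ (star x) j * ((S j)⁻¹).1
      = star ((S j)⁻¹).1 * star (S j).1 * (S j).1 *
          Φ (star x) j * ((S j)⁻¹).1 := by rw [hinv, one_mul]
    _ = star ((S j)⁻¹).1 *
          (star (S j).1 * (S j).1 * Φ (star x) j) * ((S j)⁻¹).1 := by simp only [mul_assoc]
    _ = star ((S j)⁻¹).1 *
          (star (Φ x j) * star (S j).1 * ((S j).1 * ((S j)⁻¹).1))     := by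
      rw [h]; simp only [mul_assoc]
    _ = _ := by rw [Units.mul_inv, mul_one]

/-- A tracial functional on a direct sum of matrix algebras is a combination of the normalized
traces of the blocks. -/
theorem Matrix.tracial_pi_eq_sum {J : Type*} [Fintype J] [DecidableEq J] {n : J → ℕ}
    (hn : ∀ j, 0 < n j) (f : ((j : J) → Matrix (Fin (n j)) (Fin (n j)) ℂ) →ₗ[ℂ] ℂ)
    (hf : ∀ x y, f (x * y) = f (y * x)) (x : (j : J) → Matrix (Fin (n j)) (Fin (n j)) ℂ) :
    f x = ∑ j, f (Pi.single j 1) * ((x j).trace / n j) := by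
  have hx : f x = ∑ j, f (Pi.single j (x j)) := by
    rw [← map_sum, Finset.univ_sum_single]
  rw [hx]
  refine Finset.sum_congr rfl fun j _ => ?_
  have : NeZero (n j) := ⟨(hn j).ne'⟩
  let E : Fin (n j) → Fin (n j) → ((j : J) → Matrix (Fin (n j)) (Fin (n j)) ℂ) := fun r s =>
    Pi.single j (Matrix.single r s 1)
  obtain ⟨c, hE⟩ : ∃ c : ℂ, ∀ r s, f (E r s) = if r = s then c else 0 := by
    refine ⟨f (E 0 0), fun r s => ?_⟩
    have h1 : E r s = E r 0 * E 0 s := by simp [E, ← Pi.single_mul]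
    rw [h1, hf]
    split_ifs with h
    · subst h; simp [E, ← Pi.single_mul]
    · simp [E, ← Pi.single_mul, Ne.symm h]
  have hX : ∀ X : Matrix (Fin (n j)) (Fin (n j)) ℂ, f (Pi.single j X) = c * X.trace := by
    intro X
    have h1 : (Pi.single j X : (j : J) → Matrix (Fin (n j)) (Fin (n j)) ℂ) =
        ∑ r, ∑ s, X r s • E r s := by
      funext i
      simp only [Finset.sum_apply, Pi.smul_apply, E]
      by_cases h : i = j
      · subst h
        simp only [Pi.single_eq_same]
        ext b c
        simp [Matrix.sum_apply, Matrix.single_apply, ite_and]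
      · simp [h]
    rw [h1]
    simp only [map_sum, map_smul, hE, smul_eq_mul, mul_ite, mul_zero, Finset.sum_ite_eq,
      Finset.mem_univ, if_true, Matrix.trace, Matrix.diag_apply, Finset.mul_sum]
    exact Finset.sum_congr rfl fun r _ => mul_comm _ _
  have hn0 : (n j : ℂ) ≠ 0 := NeZero.ne _
  rw [hX, hX 1, Matrix.trace_one, Fintype.card_fin]
  field_simp

end Wedderburn

/-! ### Representations of a sum of matrix algebras -/

section Inclusion

/-- A projection matrix factors through an isometry. -/
theorem Matrix.exists_isometry_of_projection {n : ℕ} {q : Matrix (Fin n) (Fin n) ℂ}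
    (hq : star q = q) (hqq : q * q = q) :
    ∃ (k : ℕ) (V : Matrix (Fin n) (Fin k) ℂ), V.conjTranspose * V = 1 ∧
      V * V.conjTranspose = q := by
  have hH : q.IsHermitian := hq
  set U := (hH.eigenvectorUnitary : Matrix (Fin n) (Fin n) ℂ) with hU
  have hUU : star U * U = 1 := Unitary.coe_star_mul_self _
  have hUU' : U * star U = 1 := Unitary.coe_mul_star_self _
  have hdiag : star U * q * U = Matrix.diagonal (RCLike.ofReal ∘ hH.eigenvalues) := by
    have := hH.conjStarAlgAut_star_eigenvectorUnitary
    rwa [Unitary.conjStarAlgAut_star_apply] at this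
  have hev : ∀ i, (hH.eigenvalues i : ℂ) = 0 ∨ (hH.eigenvalues i : ℂ) = 1 := by
    intro i
    have h1 : (star U * q * U) * (star U * q * U) = star U * q * U := by
      calc _ = star U * q * (U * star U) * q * U := by simp only [mul_assoc]
        _ = star U * (q * q) * U := by rw [hUU', mul_one]; simp only [mul_assoc]
        _ = _ := by rw [hqq]
    rw [hdiag, Matrix.diagonal_mul_diagonal] at h1
    have h2 := congrFun (congrFun h1 i) i
    rw [Matrix.diagonal_apply_eq, Matrix.diagonal_apply_eq] at h2
    exact IsIdempotentElem.iff_eq_zero_or_one.1 h2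
  have hq' : q = U * Matrix.diagonal (RCLike.ofReal ∘ hH.eigenvalues) * star U := by
    rw [← hdiag]
    calc q = (U * star U) * q * (U * star U) := by rw [hUU', one_mul, mul_one]
      _ = _ := by simp only [mul_assoc]
  classical
  -- the columns of `V` are the eigenvectors with eigenvalue `1`
  let e := (Fintype.equivFin {i // (hH.eigenvalues i : ℂ) = 1}).symm
  refine ⟨_, U.submatrix id (fun l => (e l).1), ?_, ?_⟩
  · ext l l'
    have := congrFun (congrFun hUU (e l)) (e l')
    rw [Matrix.mul_apply] at this
    rw [Matrix.mul_apply]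
    refine this.trans ?_
    simp only [Matrix.one_apply, Subtype.val_inj, e.injective.eq_iff]
  · ext r s
    rw [congrFun (congrFun hq' r) s, Matrix.mul_apply, Matrix.mul_apply]
    simp only [Matrix.mul_diagonal, Matrix.submatrix_apply, id, Matrix.conjTranspose_apply,
      Function.comp_apply, Matrix.star_apply]
    rw [e.sum_comp fun i => U r i.1 * star (U s i.1),
      ← Finset.sum_subtype (Finset.univ.filter fun i => (hH.eigenvalues i : ℂ) = 1)
        (fun i => by simp) fun i => U r i * star (U s i), Finset.sum_filter]
    refine Finset.sum_congr rfl fun i _ => ?_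
    rcases hev i with h | h
    · simp [h]
    · simp [h]

/-- A unital `*`-representation of a direct sum of matrix algebras is unitarily equivalent to a
direct sum of copies of the blocks. If the columns of `V i` are an orthonormal basis of the range
of the image of the first diagonal matrix unit of the `i`-th block, the translates of these columns
by the matrix units `(t, 1)` are an orthonormal basis of the whole space. -/
theorem Matrix.exists_unitary_conj_eq_blockDiagonal {I : ℕ} {m : Fin I → ℕ} (hm : ∀ i, 0 < m i)
    {n : ℕ} (π : ((i : Fin I) → Matrix (Fin (m i)) (Fin (m i)) ℂ) →⋆ₐ[ℂ]
      Matrix (Fin n) (Fin n) ℂ) :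
    ∃ (k : Fin I → ℕ) (coord : (Σ p : (Σ i : Fin I, Fin (k i)), Fin (m p.1)) ≃ Fin n)
      (U : unitary (Matrix (Fin n) (Fin n) ℂ)), ∀ x,
        (U : Matrix (Fin n) (Fin n) ℂ) * π x * star (U : Matrix (Fin n) (Fin n) ℂ) =
          Matrix.reindex coord coord
            (Matrix.blockDiagonal' fun p : (Σ i : Fin I, Fin (k i)) => x p.1) := by
  have : ∀ i, NeZero (m i) := fun i => ⟨(hm i).ne'⟩
  let E : ∀ i, Fin (m i) → Fin (m i) → ((i : Fin I) → Matrix (Fin (m i)) (Fin (m i)) ℂ) :=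
    fun i s t => Pi.single i (Matrix.single s t 1)
  have hEE : ∀ i s t u, E i s t * E i t u = E i s u := fun i s t u => by
    simp [E, ← Pi.single_mul]
  have hEE0 : ∀ i s t t' u, t ≠ t' → E i s t * E i t' u = 0 := fun i s t t' u h => by
    simp [E, ← Pi.single_mul, h]
  have hEE0' : ∀ i i' s t t' u, i ≠ i' → E i s t * E i' t' u = 0 := fun i i' s t t' u h => by
    funext a
    by_cases ha : a = i
    · subst ha; simp [E, h]
    · simp [E, ha]
  have hEs : ∀ i s t, star (E i s t) = E i t s := fun i s t => by
    funext a
    by_cases ha : a = i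
    · subst ha; simp [E, Matrix.star_eq_conjTranspose]
    · simp [E, ha]
  have hxE : ∀ x i t, x * E i t 0 = ∑ s, x i s t • E i s 0 := by
    intro x i t
    funext a
    rw [Finset.sum_apply]
    by_cases ha : a = i
    · subst ha
      simp only [Pi.mul_apply, Pi.smul_apply, E, Pi.single_eq_same]
      ext b c
      simp [Matrix.mul_apply, Matrix.sum_apply, Matrix.single_apply, ite_and]
    · simp [E, ha]
  have hE1 : ∑ i, ∑ t, E i t t = 1 := by
    funext a
    simp only [Finset.sum_apply]
    rw [Finset.sum_eq_single a (fun i _ h => by simp [E, h.symm]) (by simp)]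
    simp only [E, Pi.single_eq_same]
    ext b c
    simp [Matrix.sum_apply, Matrix.single_apply, Matrix.one_apply, ite_and]
  choose k V hV hV' using fun i => Matrix.exists_isometry_of_projection
    (q := π (E i 0 0)) (by rw [← map_star, hEs]) (by rw [← map_mul, hEE])
  let W : Matrix (Fin n) (Σ p : (Σ i : Fin I, Fin (k i)), Fin (m p.1)) ℂ :=
    Matrix.of fun r p => (π (E p.1.1 p.2 0) * V p.1.1) r p.1.2
  have hgram : ∀ i t i' t', (π (E i t 0) * V i).conjTranspose * (π (E i' t' 0) * V i') =
      (V i).conjTranspose * (π (E i 0 t * E i' t' 0) * V i') := by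
    intro i t i' t'
    rw [Matrix.conjTranspose_mul, ← Matrix.star_eq_conjTranspose (π _), ← map_star, hEs, map_mul]
    simp only [Matrix.mul_assoc]
  have hfix : ∀ i, π (E i 0 0) * V i = V i := fun i => by
    rw [← hV', Matrix.mul_assoc, hV, Matrix.mul_one]
  have hWW : W.conjTranspose * W = 1 := by
    ext ⟨⟨i, l⟩, t⟩ ⟨⟨i', l'⟩, t'⟩
    have h := congrFun (congrFun (hgram i t i' t') l) l'
    rw [Matrix.mul_apply] at h ⊢
    refine h.trans ?_
    by_cases hi : i = i'
    · subst hi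
      by_cases ht : t = t'
      · subst ht
        rw [hEE, hfix, hV]
        simp [Matrix.one_apply]
      · rw [hEE0 _ _ _ _ _ ht, map_zero, Matrix.zero_mul, Matrix.mul_zero]
        simp [ht]
    · rw [hEE0' _ _ _ _ _ _ hi, map_zero, Matrix.zero_mul, Matrix.mul_zero]
      simp [hi]
  have hWW' : W * W.conjTranspose = 1 := by
    rw [← map_one π, ← hE1, map_sum]
    simp only [map_sum]
    ext r s
    rw [Matrix.mul_apply, Fintype.sum_sigma, Fintype.sum_sigma, Matrix.sum_apply]
    refine Finset.sum_congr rfl fun i _ => ?_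
    change ∑ l : Fin (k i), ∑ t : Fin (m i),
      W r ⟨⟨i, l⟩, t⟩ * W.conjTranspose ⟨⟨i, l⟩, t⟩ s = _
    rw [Finset.sum_comm, Matrix.sum_apply]
    refine Finset.sum_congr rfl fun t _ => ?_
    have h1 : π (E i t t) = (π (E i t 0) * V i) * (π (E i t 0) * V i).conjTranspose := by
      rw [Matrix.conjTranspose_mul, ← Matrix.star_eq_conjTranspose (π _), ← map_star, hEs,
        Matrix.mul_assoc, ← Matrix.mul_assoc (V i), hV', ← map_mul, ← map_mul, hEE, hEE]
    rw [h1, Matrix.mul_apply]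
    rfl
  have hπW : ∀ x, π x * W =
      W * Matrix.blockDiagonal' fun p : (Σ i : Fin I, Fin (k i)) => x p.1 := by
    intro x
    ext r ⟨⟨i, l⟩, t⟩
    have h1 : π x * (π (E i t 0) * V i) = ∑ s, x i s t • (π (E i s 0) * V i) := by
      rw [← Matrix.mul_assoc, ← map_mul, hxE, map_sum, Matrix.sum_mul]
      simp only [map_smul, Matrix.smul_mul]
    have h2 := congrFun (congrFun h1 r) l
    rw [Matrix.mul_apply] at h2 ⊢
    refine h2.trans ?_
    rw [Matrix.mul_apply, Fintype.sum_sigma, Matrix.sum_apply,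
      Finset.sum_eq_single (⟨i, l⟩ : Σ i : Fin I, Fin (k i))]
    · refine Finset.sum_congr rfl fun s _ => ?_
      rw [Matrix.blockDiagonal'_apply_eq, Matrix.smul_apply, smul_eq_mul, mul_comm]
      rfl
    · intro p _ hp
      refine Finset.sum_eq_zero fun s _ => ?_
      rw [Matrix.blockDiagonal'_apply_ne _ _ _ hp, mul_zero]
    · simp
  let coord : (Σ p : (Σ i : Fin I, Fin (k i)), Fin (m p.1)) ≃ Fin n :=
    Fintype.equivOfCardEq (Matrix.square_of_invertible _ _ hWW hWW')
  let U : Matrix (Fin n) (Fin n) ℂ := W.conjTranspose.submatrix coord.symm id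
  have hUs : star U = W.submatrix id coord.symm := by
    rw [Matrix.star_eq_conjTranspose, Matrix.conjTranspose_submatrix,
      Matrix.conjTranspose_conjTranspose]
  have hUmul : ∀ X : Matrix (Fin n) (Σ p : (Σ i : Fin I, Fin (k i)), Fin (m p.1)) ℂ,
      U * X.submatrix id coord.symm =
        (W.conjTranspose * X).submatrix coord.symm coord.symm := fun X => rfl
  have hUU : U * star U = 1 := by
    rw [hUs, hUmul, hWW, Matrix.submatrix_one_equiv]
  refine ⟨k, coord, ⟨U, Unitary.mem_iff.2 ⟨mul_eq_one_comm.1 hUU, hUU⟩⟩, fun x => ?_⟩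
  change U * π x * star U = _
  have hπU : π x * W.submatrix id coord.symm = (π x * W).submatrix id coord.symm := rfl
  rw [hUs, Matrix.mul_assoc, hπU, hπW, hUmul, ← Matrix.mul_assoc, hWW, Matrix.one_mul,
    Matrix.reindex_apply]

end Inclusion

/-- Both algebras are sums of matrix algebras; the coordinates of `M` are conjugated by a unitary
to bring the inclusion into block diagonal form. -/
theorem nonempty_blockDecomposition {M : Type u} [CStarAlgebra M] [FiniteDimensional ℂ M]
    (τ : FaithfulTrace M) (A : StarSubalgebra ℂ M) : Nonempty (BlockDecomposition τ A) := by
  obtain ⟨J, n, hn, ⟨Φ⟩⟩ := exists_starAlgEquiv_pi_matrix τ.toLinearMap τ.map_star τ.nonneg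
    τ.faithful
  have : FiniteDimensional ℂ A :=
    inferInstanceAs (FiniteDimensional ℂ (Subalgebra.toSubmodule A.toSubalgebra))
  obtain ⟨I, m, hm, ⟨Ψ⟩⟩ := exists_starAlgEquiv_pi_matrix
    (τ.toLinearMap ∘ₗ A.subtype.toAlgHom.toLinearMap)
    (fun x => τ.map_star x) (fun x => τ.nonneg x)
    (fun x hx => Subtype.ext (τ.faithful x hx))
  let π : ∀ j, ((i : Fin I) → Matrix (Fin (m i)) (Fin (m i)) ℂ) →⋆ₐ[ℂ]
      Matrix (Fin (n j)) (Fin (n j)) ℂ := fun j =>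
    (Pi.evalStarAlgHom ℂ (fun j => Matrix (Fin (n j)) (Fin (n j)) ℂ) j).comp
      ((Φ.toStarAlgHom.comp A.subtype).comp Ψ.symm.toStarAlgHom)
  choose k coord U hU using fun j => Matrix.exists_unitary_conj_eq_blockDiagonal hm (π j)
  let u : unitary ((j : Fin J) → Matrix (Fin (n j)) (Fin (n j)) ℂ) :=
    ⟨fun j => U j, Unitary.mem_iff.2
      ⟨funext fun j => Unitary.coe_star_mul_self (U j),
        funext fun j => Unitary.coe_mul_star_self (U j)⟩⟩
  let blocks := Φ.trans (Unitary.conjStarAlgAut ℂ _ u)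
  have htr := Matrix.tracial_pi_eq_sum hn (τ.toLinearMap ∘ₗ blocks.symm.toAlgEquiv.toLinearMap)
    fun x y => by
      simp only [LinearMap.comp_apply, AlgEquiv.toLinearMap_apply, map_mul]
      exact τ.mul_comm _ _
  have hβ : ∀ j, ((τ (blocks.symm (Pi.single j 1))).re : ℂ) = τ (blocks.symm (Pi.single j 1)) := by
    intro j
    refine Complex.ext rfl (τ.im_selfAdjoint _ ?_).symm
    rw [← map_star]
    congr 1
    funext i
    by_cases h : i = j
    · subst h; simp
    · simp [h]
  exact ⟨{
    J := J, I := I, n := n, n_pos := hn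
    β := fun j => (τ (blocks.symm (Pi.single j 1))).re
    m := m, m_pos := hm
    k := fun i j => k j i
    blocks := blocks, subBlocks := Ψ
    trace_eq := fun x => by
      simp only [hβ]
      have := htr (blocks x)
      simpa using this
    coord := coord
    inclusion_eq := fun a j => by
      rw [← hU]
      change (U j : Matrix (Fin (n j)) (Fin (n j)) ℂ) * Φ a j * star (U j).1 =
        (U j).1 * Φ (Ψ.symm (Ψ a) : A) j * star (U j).1
      rw [Ψ.symm_apply_apply] }⟩

theorem mainTheorem9 {M : Type u} [CStarAlgebra M] [FiniteDimensional ℂ M]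
    (τ : FaithfulTrace M) (A : StarSubalgebra ℂ M) :
    Nonempty (BlockDecomposition τ A) ∧
    (∀ B : BlockDecomposition τ A,
      (trStructure τ).dcl (A : Set M) =
        (Submodule.span ℂ {x : M | ∃ C ∈ B.blockSetoid.classes, ∃ a ∈ A, x = B.proj C * a} :
          Set M)) ∧
    (trStructure τ).acl (A : Set M) = Set.univ := by
  refine ⟨nonempty_blockDecomposition τ A, fun B => ?_, acl_eq_univ⟩
  rw [← traceFixedPoints_eq_dcl]
  exact B.traceFixedPoints_subset_span.antisymm B.span_subset_traceFixedPoints
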